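/- Consider the 3d Toric Code on the cubic lattice $\mathbb{Z}^3$: there is a qubit on every edge, $\mathfrak{A}$ is the quasi-local $C^*$-algebra (the norm closure of the union of the matrix algebras $\bigotimes_{e\in\Lambda}M_2(\mathbb{C})$ over finite sets $\Lambda$ of edges), $A_v=\prod_{e\ni v}\sigma^x_e$ for every vertex $v$ (product over the six edges at $v$) and $B_f=\prod_{e\in f}\sigma^z_e$ for every face $f$ (product over its four edges). A state is a positive normalized linear functional on $\mathfrak{A}$, and it is pure if it is an extreme point of the convex set of states. For a vertex $v$ let $\gamma_{v;n}$ be the straight path of $n$ edges from $v$ down to $v-n\hat z$, and $$\alpha_v(O)=\lim_{n\to\infty}F_{\gamma_{v;n}}\,O\,F_{\gamma_{v;n}},\qquad F_\gamma=\prod_{e\in\gamma}\sigma^z_e .$$ An infinite path $\bar\gamma$ is a bi-infinite sequence of oriented edges of the dual lattice, each starting where the previous one ends, without self-intersection (in every finite segment no nonempty proper subset of the edges has vanishing total boundary). A bounding sequence for $\bar\gamma$ is an increasing sequence $(\bar S_n)$ of finite sets of faces of the dual lattice such that every dual edge belongs, for all large $n$, to the mod-2 boundary of $\bar S_n$ if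 and only if it is traversed by $\bar\gamma$. For such a sequence put $$\alpha_{\bar\gamma}(O)=\lim_{n\to\infty}F_{\bar S_n}\,O\,F_{\bar S_n},\qquad F_{\bar S}=\prod_{e\perp\bar S}\sigma^x_e ,$$ where $e\perp\bar S$ means that $e$ is dual to a face in $\bar S$. Theorem. There is exactly one state $\omega$ on $\mathfrak{A}$ with $\omega(A_v)=\omega(B_f)=1$ for all $v,f$, and it is pure. For every vertex $v$ the limit $\alpha_v$ exists (in norm, for every $O\in\mathfrak{A}$) and is a $*$-automorphism of $\mathfrak{A}$. Every infinite path $\bar\gamma$ has a bounding sequence, and for every bounding sequence the limit $\alpha_{\bar\gamma}$ exists and is a $*$-automorphism of $\mathfrak{A}$. For all $n,m\ge 0$, all vertices $v_1,\dots,v_n$, all infinite paths $\bar\gamma_1,\dots,\bar\gamma_m$ and all choices of bounding sequences for them, the state $$\omega_{v_1,\dots,v_n;\bar\gamma_1,\dots,\bar\gamma_m}=\omega\circ\alpha_{v_1}\circ\cdots\circ\alpha_{v_n}\circ\alpha_{\bar\gamma_1}\circ\cdots\circ\alpha_{\bar\gamma_m}$$ is pure. -/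

import Mathlib

open Filter Topology
open scoped ENNReal ComplexOrder

namespace ToricCode

/-! ## The lattice `ℤ³` and its dual -/

/-- Vertices of the cubic lattice `ℤ³`. The dual lattice is again a copy of `ℤ³`: the dual vertex `w`
sits at the point `w + (1/2, 1/2, 1/2)`, i.e. at the centre of the unit cube with lowest corner `w`. -/
abbrev Vertex : Type := Fin 3 → ℤ

/-- The `r`-th unit vector. -/
def unit (r : Fin 3) : Vertex := Pi.single r 1

/-- The edge from `base` to `base + unit dir`, pointing in the positive direction
(of the lattice or of the dual lattice). -/
@[ext] structure Edge : Type where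
  base : Vertex
  dir : Fin 3
deriving DecidableEq

/-- The unit square with lowest corner `base` spanned by the two directions other than `normal`
(of the lattice or of the dual lattice). -/
@[ext] structure Face : Type where
  base : Vertex
  normal : Fin 3
deriving DecidableEq

/-- The six edges having `v` as an endpoint. -/
def starEdges (v : Vertex) : Finset Edge :=
  Finset.univ.biUnion fun r : Fin 3 => {⟨v, r⟩, ⟨v - unit r, r⟩}

/-- The four edges of a face; in `Fin 3` the two directions spanning it are
`normal + 1` and `normal + 2`. -/
def Face.edges (f : Face) : Finset Edge :=
  {⟨f.base, f.normal + 1⟩, ⟨f.base + unit (f.normal + 2), f.normal + 1⟩,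
   ⟨f.base, f.normal + 2⟩, ⟨f.base + unit (f.normal + 1), f.normal + 2⟩}

/-- The edge of the lattice dual to (that is, crossing) the face `f` of the dual lattice. The centre
of `f` is `f.base + (1/2, 1/2, 1/2)` plus half of the two unit vectors spanning `f`, and this is the
midpoint of the edge below. -/
def Face.dualEdge (f : Face) : Edge :=
  ⟨f.base + unit (f.normal + 1) + unit (f.normal + 2), f.normal⟩

/-- The boundary (mod 2) of a finite set of faces: the edges lying on an odd number of the faces. -/
def boundary (S : Finset Face) : Set Edge :=
  {e | Odd (S.filter fun f => e ∈ f.edges).card}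

/-! ## The quasi-local algebra -/

/-- Classical configurations: a basis label `0` or `1` of `ℂ²` at every edge. -/
abbrev Config : Type := Edge → Fin 2

/-- The Hilbert space `ℓ²(Config)`, on which all the matrix algebras of the finite regions act
compatibly and faithfully. -/
abbrev Hilb : Type := lp (fun _ : Config => ℂ) 2

/-- The configuration with the label at `e` replaced by `j`. -/
def setAt (s : Config) (e : Edge) (j : Fin 2) : Config := Function.update s e j

/-- The action of a `2 × 2` matrix on the tensor factor at `e`, on functions of configurations. -/
def siteFun (e : Edge) (M : Matrix (Fin 2) (Fin 2) ℂ) (ψ : Config → ℂ) : Config → ℂ :=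
  fun s => ∑ j : Fin 2, M (s e) j * ψ (setAt s e j)

/-- Flipping the label at `e`. -/
def flipAt (e : Edge) : Config ≃ Config where
  toFun s := setAt s e (s e + 1)
  invFun s := setAt s e (s e + 1)
  left_inv s := by
    have h : ∀ a : Fin 2, a + 1 + 1 = a := by decide
    simp [setAt, h]
  right_inv s := by
    have h : ∀ a : Fin 2, a + 1 + 1 = a := by decide
    simp [setAt, h]

/-- A bound for the entries of a matrix. -/
noncomputable def entryBound (M : Matrix (Fin 2) (Fin 2) ℂ) : ℝ := ∑ i, ∑ j, ‖M i j‖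

lemma entryBound_nonneg (M : Matrix (Fin 2) (Fin 2) ℂ) : 0 ≤ entryBound M :=
  Finset.sum_nonneg fun _ _ => Finset.sum_nonneg fun _ _ => norm_nonneg _

lemma norm_le_entryBound (M : Matrix (Fin 2) (Fin 2) ℂ) (i j : Fin 2) : ‖M i j‖ ≤ entryBound M :=
  (Finset.single_le_sum (f := fun j => ‖M i j‖) (fun _ _ => norm_nonneg _) (Finset.mem_univ j)).trans
    (Finset.single_le_sum (f := fun i => ∑ j, ‖M i j‖)
      (fun _ _ => Finset.sum_nonneg fun _ _ => norm_nonneg _) (Finset.mem_univ i))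

lemma siteFun_eq (e : Edge) (M : Matrix (Fin 2) (Fin 2) ℂ) (ψ : Config → ℂ) (s : Config) :
    siteFun e M ψ s = M (s e) (s e) * ψ s + M (s e) (s e + 1) * ψ (flipAt e s) := by
  have h0 : setAt s e (s e) = s := Function.update_eq_self e s
  have h : ∀ (a : Fin 2) (g : Fin 2 → ℂ), ∑ j, g j = g a + g (a + 1) := by
    intro a g
    fin_cases a
    · simp [Fin.sum_univ_two]
    · simp [Fin.sum_univ_two, add_comm]
  simp only [siteFun]
  rw [h (s e), h0]
  rfl

lemma siteFun_sq_le (e : Edge) (M : Matrix (Fin 2) (Fin 2) ℂ) (ψ : Config → ℂ) (s : Config) :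
    ‖siteFun e M ψ s‖ ^ 2 ≤
      2 * entryBound M ^ 2 * (‖ψ s‖ ^ 2 + ‖ψ (flipAt e s)‖ ^ 2) := by
  have hC := entryBound_nonneg M
  have h : ‖siteFun e M ψ s‖ ≤ entryBound M * (‖ψ s‖ + ‖ψ (flipAt e s)‖) := by
    rw [siteFun_eq, mul_add]
    refine (norm_add_le _ _).trans (add_le_add ?_ ?_)
    · rw [norm_mul]; gcongr; exact norm_le_entryBound M _ _
    · rw [norm_mul]; gcongr; exact norm_le_entryBound M _ _
  calc ‖siteFun e M ψ s‖ ^ 2 ≤ (entryBound M * (‖ψ s‖ + ‖ψ (flipAt e s)‖)) ^ 2 := by gcongr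
    _ = entryBound M ^ 2 * (‖ψ s‖ + ‖ψ (flipAt e s)‖) ^ 2 := by ring
    _ ≤ entryBound M ^ 2 * (2 * (‖ψ s‖ ^ 2 + ‖ψ (flipAt e s)‖ ^ 2)) := by
        gcongr
        nlinarith [sq_nonneg (‖ψ s‖ - ‖ψ (flipAt e s)‖)]
    _ = _ := by ring

lemma hasSum_sq (ψ : Hilb) : HasSum (fun s => ‖ψ s‖ ^ 2) (‖ψ‖ ^ 2) := by
  have h := lp.hasSum_norm (p := 2) (by norm_num) ψ
  simpa using h

lemma hasSum_bound (e : Edge) (M : Matrix (Fin 2) (Fin 2) ℂ) (ψ : Hilb) :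
    HasSum (fun s => 2 * entryBound M ^ 2 * (‖ψ s‖ ^ 2 + ‖ψ (flipAt e s)‖ ^ 2))
      (2 * entryBound M ^ 2 * (‖ψ‖ ^ 2 + ‖ψ‖ ^ 2)) :=
  ((hasSum_sq ψ).add ((flipAt e).hasSum_iff.mpr (hasSum_sq ψ))).mul_left _

lemma siteFun_mem (e : Edge) (M : Matrix (Fin 2) (Fin 2) ℂ) (ψ : Hilb) :
    Memℓp (siteFun e M ψ) 2 := by
  refine memℓp_gen ?_
  simp only [ENNReal.toReal_ofNat, Real.rpow_ofNat]
  exact Summable.of_nonneg_of_le (fun _ => by positivity) (siteFun_sq_le e M ψ)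
    (hasSum_bound e M ψ).summable

/-- The matrix `M` acting on the tensor factor at `e`, and the identity on all other tensor factors,
as a bounded operator on `Hilb`. -/
noncomputable def siteOp (e : Edge) (M : Matrix (Fin 2) (Fin 2) ℂ) : Hilb →L[ℂ] Hilb :=
  LinearMap.mkContinuous
    { toFun := fun ψ => ⟨siteFun e M ψ, siteFun_mem e M ψ⟩
      map_add' := fun ψ φ => by
        ext s
        change siteFun e M _ s = siteFun e M _ s + siteFun e M _ s
        simp only [siteFun_eq, lp.coeFn_add, Pi.add_apply]
        ring
      map_smul' := fun c ψ => by
        ext s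
        change siteFun e M _ s = c * siteFun e M _ s
        simp only [siteFun_eq, lp.coeFn_smul, Pi.smul_apply, smul_eq_mul]
        ring }
    (2 * entryBound M) (fun ψ => by
      have hC := entryBound_nonneg M
      refine lp.norm_le_of_tsum_le (p := 2) (by norm_num) (by positivity) ?_
      simp only [ENNReal.toReal_ofNat, Real.rpow_ofNat]
      have hle := ((hasSum_bound e M ψ).summable.of_nonneg_of_le
        (fun _ => by positivity) (siteFun_sq_le e M ψ)).tsum_le_tsum
        (siteFun_sq_le e M ψ) (hasSum_bound e M ψ).summable
      rw [(hasSum_bound e M ψ).tsum_eq] at hle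
      refine hle.trans (le_of_eq ?_)
      ring)

lemma siteOp_apply (e : Edge) (M : Matrix (Fin 2) (Fin 2) ℂ) (ψ : Hilb) (s : Config) :
    siteOp e M ψ s = M (s e) (s e) * ψ s + M (s e) (s e + 1) * ψ (flipAt e s) :=
  siteFun_eq e M ψ s

lemma op_mul_apply (A B : Hilb →L[ℂ] Hilb) (ψ : Hilb) : (A * B) ψ = A (B ψ) := rfl

lemma flipAt_same (e : Edge) (s : Config) : flipAt e s e = s e + 1 := by
  simp [flipAt, setAt]

lemma flipAt_ne {e e' : Edge} (h : e' ≠ e) (s : Config) : flipAt e s e' = s e' := by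
  simp [flipAt, setAt, h]

lemma flipAt_flipAt (e : Edge) (s : Config) : flipAt e (flipAt e s) = s :=
  (flipAt e).left_inv s

lemma flipAt_comm (e e' : Edge) (s : Config) :
    flipAt e (flipAt e' s) = flipAt e' (flipAt e s) := by
  by_cases h : e = e'
  · rw [h]
  · funext x
    by_cases h1 : x = e
    · subst h1
      rw [flipAt_same, flipAt_ne h, flipAt_ne h, flipAt_same]
    · by_cases h2 : x = e'
      · subst h2
        rw [flipAt_ne h1, flipAt_same, flipAt_same, flipAt_ne h1]
      · rw [flipAt_ne h1, flipAt_ne h2, flipAt_ne h2, flipAt_ne h1]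

lemma siteOp_commute {e e' : Edge} (h : e ≠ e') (M N : Matrix (Fin 2) (Fin 2) ℂ) :
    Commute (siteOp e M) (siteOp e' N) := by
  refine ContinuousLinearMap.ext fun ψ => ?_
  ext s
  simp only [op_mul_apply, siteOp_apply, flipAt_ne h, flipAt_ne h.symm, flipAt_comm e e']
  ring

lemma siteOp_mul (e : Edge) (M N : Matrix (Fin 2) (Fin 2) ℂ) :
    siteOp e (M * N) = siteOp e M * siteOp e N := by
  have h : ∀ (a : Fin 2) (g : Fin 2 → ℂ), ∑ j, g j = g a + g (a + 1) := by
    intro a g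
    fin_cases a
    · simp [Fin.sum_univ_two]
    · simp [Fin.sum_univ_two, add_comm]
  have h2 : ∀ a : Fin 2, a + 1 + 1 = a := by decide
  refine ContinuousLinearMap.ext fun ψ => ?_
  ext s
  simp only [op_mul_apply, siteOp_apply, flipAt_same, flipAt_flipAt, Matrix.mul_apply,
    h (s e), h2]
  ring

lemma siteOp_one (e : Edge) : siteOp e 1 = 1 := by
  refine ContinuousLinearMap.ext fun ψ => ?_
  ext s
  have h : ∀ a : Fin 2, a ≠ a + 1 := by decide
  simp [siteOp_apply, h]

lemma siteOp_star (e : Edge) (M : Matrix (Fin 2) (Fin 2) ℂ) :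
    siteOp e (star M) = star (siteOp e M) := by
  rw [ContinuousLinearMap.star_eq_adjoint, ContinuousLinearMap.eq_adjoint_iff]
  intro ψ φ
  have h2 : ∀ a : Fin 2, a + 1 + 1 = a := by decide
  obtain ⟨D, hD1, hD2⟩ : ∃ D : Matrix (Fin 2) (Fin 2) ℂ,
      (∀ a, D a a = M a a) ∧ ∀ a, D a (a + 1) = 0 :=
    ⟨fun i j => if i = j then M i j else 0, by simp, fun a => by fin_cases a <;> simp⟩
  let f : Config → ℂ := fun s => inner ℂ (ψ s) (siteOp e D φ s)
  let g : Config → ℂ := fun s => inner ℂ (ψ s) (siteOp e M φ s)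
  let k : Config → ℂ := fun s => g s - f s
  have hf : Summable f := lp.summable_inner _ _
  have hg : Summable g := lp.summable_inner _ _
  have hk : Summable k := hg.sub hf
  have hL : ∀ s, inner ℂ (siteOp e (star M) ψ s) (φ s) = f s + k (flipAt e s) := by
    intro s
    simp only [f, g, k, siteOp_apply, hD1, hD2, flipAt_same, flipAt_flipAt, h2,
      Matrix.star_apply, RCLike.inner_apply, map_add, map_mul, RCLike.star_def, RCLike.conj_conj]
    ring
  have h3 : HasSum (fun s => f s + k (flipAt e s)) (∑' s, f s + ∑' s, k s) :=
    hf.hasSum.add ((flipAt e).hasSum_iff.mpr hk.hasSum)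
  have h4 : HasSum g (∑' s, f s + ∑' s, k s) := by
    have h5 := hf.hasSum.add hk.hasSum
    have h6 : (fun s => f s + k s) = g := by funext s; simp only [k]; ring
    rwa [h6] at h5
  have hL' : inner ℂ (siteOp e (star M) ψ) φ = ∑' s, (f s + k (flipAt e s)) :=
    (lp.inner_eq_tsum _ _).trans (tsum_congr hL)
  have hR' : inner ℂ ψ (siteOp e M φ) = ∑' s, g s := lp.inner_eq_tsum _ _
  rw [hL', hR', h3.tsum_eq, h4.tsum_eq]

/-- The matrix algebra `M₂(ℂ)` acting on the tensor factor at `e`. -/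
noncomputable def siteRep (e : Edge) :
    Matrix (Fin 2) (Fin 2) ℂ →⋆ₐ[ℂ] (Hilb →L[ℂ] Hilb) where
  toFun := siteOp e
  map_one' := siteOp_one e
  map_mul' := siteOp_mul e
  map_zero' := by
    refine ContinuousLinearMap.ext fun ψ => ?_
    ext s
    simp [siteOp_apply]
  map_add' M N := by
    refine ContinuousLinearMap.ext fun ψ => ?_
    ext s
    change siteOp e (M + N) ψ s = siteOp e M ψ s + siteOp e N ψ s
    simp only [siteOp_apply, Matrix.add_apply]
    ring
  commutes' c := by
    refine ContinuousLinearMap.ext fun ψ => ?_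
    ext s
    have h : ∀ a : Fin 2, a ≠ a + 1 := by decide
    simp [siteOp_apply, h, Algebra.algebraMap_eq_smul_one]
  map_star' := siteOp_star e

/-- The algebra `⊗_{e ∈ Λ} M₂(ℂ)` of the observables of a finite region `Λ`, embedded by tensoring
with the identity on all other edges. -/
noncomputable def localAlgebra (Λ : Finset Edge) : StarSubalgebra ℂ (Hilb →L[ℂ] Hilb) :=
  ⨆ e ∈ Λ, (siteRep e).range

/-- The C*-algebra of quasi-local observables: the norm closure of the union of the increasing family
of the algebras of finite regions. -/
noncomputable def quasiLocal : StarSubalgebra ℂ (Hilb →L[ℂ] Hilb) :=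
  (⨆ Λ : Finset Edge, localAlgebra Λ).topologicalClosure

/-- The quasi-local algebra as a type. -/
abbrev Obs : Type := quasiLocal

lemma siteRep_mem (e : Edge) (M : Matrix (Fin 2) (Fin 2) ℂ) : siteRep e M ∈ quasiLocal := by
  refine StarSubalgebra.le_topologicalClosure _ ?_
  have h1 : localAlgebra {e} ≤ ⨆ Λ : Finset Edge, localAlgebra Λ := le_iSup localAlgebra {e}
  have h2 : (siteRep e).range ≤ localAlgebra {e} :=
    le_iSup₂_of_le e (Finset.mem_singleton_self e) le_rfl
  exact h1 (h2 ⟨M, rfl⟩)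

/-- The Pauli matrix `σˣ` at the edge `e`. -/
noncomputable def sigmaX (e : Edge) : Obs := ⟨siteRep e !![0, 1; 1, 0], siteRep_mem e _⟩

/-- The Pauli matrix `σᶻ` at the edge `e`. -/
noncomputable def sigmaZ (e : Edge) : Obs := ⟨siteRep e !![1, 0; 0, -1], siteRep_mem e _⟩

lemma sigmaX_commute (e e' : Edge) : Commute (sigmaX e) (sigmaX e') := by
  by_cases h : e = e'
  · rw [h]
  · exact Subtype.ext (siteOp_commute h _ _)

lemma sigmaZ_commute (e e' : Edge) : Commute (sigmaZ e) (sigmaZ e') := by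
  by_cases h : e = e'
  · rw [h]
  · exact Subtype.ext (siteOp_commute h _ _)

/-- The product of the (commuting) operators `σˣ` over a finite set of edges. -/
noncomputable def prodX (E : Finset Edge) : Obs :=
  E.noncommProd sigmaX fun e _ e' _ _ => sigmaX_commute e e'

/-- The product of the (commuting) operators `σᶻ` over a finite set of edges. -/
noncomputable def prodZ (E : Finset Edge) : Obs :=
  E.noncommProd sigmaZ fun e _ e' _ _ => sigmaZ_commute e e'

/-- The star operator `A_v`. -/
noncomputable def starOp (v : Vertex) : Obs := prodX (starEdges v)

/-- The plaquette operator `B_f`. -/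
noncomputable def faceOp (f : Face) : Obs := prodZ f.edges

/-! ## States -/

/-- A state: a positive normalized linear functional. -/
structure IsState (ω : Obs →ₗ[ℂ] ℂ) : Prop where
  nonneg : ∀ O : Obs, 0 ≤ ω (star O * O)
  map_one : ω 1 = 1

/-- A pure state: an extreme point of the convex set of all states. -/
def IsPure (ω : Obs →ₗ[ℂ] ℂ) : Prop :=
  ω ∈ Set.extremePoints ℝ {φ : Obs →ₗ[ℂ] ℂ | IsState φ}

/-- A state with `ω (A_v) = ω (B_f) = 1` for all vertices `v` and faces `f`. -/
structure IsVacuum (ω : Obs →ₗ[ℂ] ℂ) : Prop where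
  isState : IsState ω
  star_eq_one : ∀ v : Vertex, ω (starOp v) = 1
  face_eq_one : ∀ f : Face, ω (faceOp f) = 1

/-- The functional `ω ∘ α`. -/
noncomputable def pullback (ω : Obs →ₗ[ℂ] ℂ) (α : Obs ≃⋆ₐ[ℂ] Obs) : Obs →ₗ[ℂ] ℂ where
  toFun O := ω (α O)
  map_add' O P := by rw [map_add, map_add]
  map_smul' c O := by rw [map_smul, map_smul]; rfl

/-! ## Charge automorphisms -/

/-- The `n` edges of the straight path from `v` down to `v - n ẑ`. -/
def downPath (v : Vertex) (n : ℕ) : Finset Edge :=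
  (Finset.range n).image fun k : ℕ => ⟨v - ((k : ℤ) + 1) • unit 2, 2⟩

/-- `α` is the charge automorphism `α_v`, the pointwise norm limit of the conjugations with the
string operators `∏ σᶻ` along the paths from `v` down to `v - n ẑ`. -/
def IsChargeAut (v : Vertex) (α : Obs ≃⋆ₐ[ℂ] Obs) : Prop :=
  ∀ O : Obs, Tendsto (fun n : ℕ => prodZ (downPath v n) * O * prodZ (downPath v n)) atTop (𝓝 (α O))

/-! ## Infinite flux strings -/

/-- An edge together with one of its two orientations. -/
structure OrientedEdge : Type where
  edge : Edge
  reversed : Bool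

/-- The start vertex of an oriented edge. -/
def OrientedEdge.source (e : OrientedEdge) : Vertex :=
  if e.reversed then e.edge.base + unit e.edge.dir else e.edge.base

/-- The end vertex of an oriented edge. -/
def OrientedEdge.target (e : OrientedEdge) : Vertex :=
  if e.reversed then e.edge.base else e.edge.base + unit e.edge.dir

/-- The boundary (end vertex minus start vertex) of an oriented edge, as a formal sum of vertices. -/
noncomputable def OrientedEdge.bdry (e : OrientedEdge) : Vertex →₀ ℤ :=
  Finsupp.single e.target 1 - Finsupp.single e.source 1

/-- The oriented edges `γ a, …, γ b` form a finite path: consecutive edges fit together, and there is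
no self-intersection, i.e. no nonempty proper subcollection has zero total boundary. -/
def IsFinitePath (γ : ℤ → OrientedEdge) (a b : ℤ) : Prop :=
  (∀ t ∈ Finset.Ico a b, (γ t).target = (γ (t + 1)).source) ∧
    ∀ T ⊂ Finset.Icc a b, T.Nonempty → ∑ t ∈ T, (γ t).bdry ≠ 0

/-- An infinite path: a bi-infinite sequence of oriented edges (of the dual lattice) all of whose
finite segments are finite paths. -/
def IsInfinitePath (γ : ℤ → OrientedEdge) : Prop :=
  ∀ a b : ℤ, IsFinitePath γ a b

/-- The (unoriented) edges traversed by `γ`. -/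
def support (γ : ℤ → OrientedEdge) : Set Edge := {e | ∃ t : ℤ, (γ t).edge = e}

/-- The flux operator of a finite dual surface `S`: the product of `σˣ` over the edges of the lattice
dual to the faces in `S`. -/
noncomputable def fluxOp (S : Finset Face) : Obs := prodX (S.image Face.dualEdge)

/-- A choice of bounding surfaces for the infinite path `γ`: an increasing sequence of finite sets
of dual faces whose boundaries contain larger and larger pieces of `γ`, exhausting it, while every
dual edge off `γ` eventually stops being a boundary edge. -/
structure IsBoundingSequence (γ : ℤ → OrientedEdge) (S : ℕ → Finset Face) : Prop where
  mono : Monotone S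
  boundary_tendsto : ∀ e : Edge, ∀ᶠ n in atTop, (e ∈ boundary (S n) ↔ e ∈ support γ)

/-- `α` is the infinite flux automorphism `α_γ` defined by the surfaces `S n`, the pointwise norm
limit of the conjugations with their flux operators. -/
def IsFluxAut (S : ℕ → Finset Face) (α : Obs ≃⋆ₐ[ℂ] Obs) : Prop :=
  ∀ O : Obs, Tendsto (fun n : ℕ => fluxOp (S n) * O * fluxOp (S n)) atTop (𝓝 (α O))

end ToricCode

open ToricCode

namespace ToricCode

/-! ## Pauli operators -/

/-- Flipping the labels at all edges of a set. -/
def flipSet (E : Finset Edge) (s : Config) : Config := fun e => if e ∈ E then s e + 1 else s e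

/-- The eigenvalue of `σᶻ` at a label. -/
def zSign (a : Fin 2) : ℂ := if a = 0 then 1 else -1

/-- The eigenvalue of `prodZ E` at a configuration. -/
noncomputable def zChar (E : Finset Edge) (s : Config) : ℂ := ∏ e ∈ E, zSign (s e)

lemma fin_two_add_add (a : Fin 2) : a + 1 + 1 = a := by
  revert a; decide

lemma flipSet_empty (s : Config) : flipSet ∅ s = s := by
  funext e
  simp [flipSet]

lemma flipSet_flipAt {e : Edge} {E : Finset Edge} (h : e ∉ E) (s : Config) :
    flipSet E (flipAt e s) = flipSet (insert e E) s := by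
  funext x
  by_cases hx : x = e
  · subst hx
    simp [flipSet, h, flipAt_same]
  · simp [flipSet, hx, flipAt_ne hx]

lemma flipSet_flipSet (E F : Finset Edge) (s : Config) :
    flipSet F (flipSet E s) = flipSet (symmDiff E F) s := by
  funext e
  by_cases h1 : e ∈ E <;> by_cases h2 : e ∈ F <;>
    simp [flipSet, Finset.mem_symmDiff, h1, h2, fin_two_add_add]

lemma zSign_mul_self (a : Fin 2) : zSign a * zSign a = 1 := by
  unfold zSign; split_ifs <;> simp

lemma zSign_add_one (a : Fin 2) : zSign (a + 1) = -zSign a := by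
  fin_cases a <;> simp [zSign]

lemma zSign_add (a b : Fin 2) : zSign (a + b) = zSign a * zSign b := by
  fin_cases a <;> fin_cases b <;> simp [zSign]

lemma obs_ext {O P : Obs} (h : ∀ (ψ : Hilb) (s : Config), O.1 ψ s = P.1 ψ s) : O = P := by
  refine Subtype.ext (ContinuousLinearMap.ext fun ψ => ?_)
  ext s
  exact h ψ s

lemma obs_mul_apply (O P : Obs) (ψ : Hilb) : (O * P).1 ψ = O.1 (P.1 ψ) := rfl

lemma sigmaX_apply (e : Edge) (ψ : Hilb) (s : Config) : (sigmaX e).1 ψ s = ψ (flipAt e s) := by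
  change siteOp e _ ψ s = _
  rw [siteOp_apply]
  generalize s e = a
  fin_cases a <;> simp

lemma sigmaZ_apply (e : Edge) (ψ : Hilb) (s : Config) :
    (sigmaZ e).1 ψ s = zSign (s e) * ψ s := by
  change siteOp e _ ψ s = _
  rw [siteOp_apply]
  generalize s e = a
  fin_cases a <;> simp [zSign]

lemma prodX_empty : prodX ∅ = 1 := Finset.noncommProd_empty _ _

lemma prodZ_empty : prodZ ∅ = 1 := Finset.noncommProd_empty _ _

lemma prodX_insert {e : Edge} {E : Finset Edge} (h : e ∉ E) :
    prodX (insert e E) = sigmaX e * prodX E := Finset.noncommProd_insert_of_notMem _ _ _ _ h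

lemma prodZ_insert {e : Edge} {E : Finset Edge} (h : e ∉ E) :
    prodZ (insert e E) = sigmaZ e * prodZ E := Finset.noncommProd_insert_of_notMem _ _ _ _ h

lemma prodX_singleton (e : Edge) : prodX {e} = sigmaX e := Finset.noncommProd_singleton _ _

lemma prodZ_singleton (e : Edge) : prodZ {e} = sigmaZ e := Finset.noncommProd_singleton _ _

lemma prodX_apply (E : Finset Edge) (ψ : Hilb) (s : Config) :
    (prodX E).1 ψ s = ψ (flipSet E s) := by
  induction E using Finset.induction_on generalizing s with
  | empty => simp [prodX_empty, flipSet_empty]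
  | insert e E h ih =>
    rw [prodX_insert h, obs_mul_apply, sigmaX_apply, ih, flipSet_flipAt h]

lemma prodZ_apply (E : Finset Edge) (ψ : Hilb) (s : Config) :
    (prodZ E).1 ψ s = zChar E s * ψ s := by
  induction E using Finset.induction_on with
  | empty => simp [prodZ_empty, zChar]
  | insert e E h ih =>
    rw [prodZ_insert h, obs_mul_apply, sigmaZ_apply, ih, zChar, zChar, Finset.prod_insert h,
      mul_assoc]

lemma zChar_symmDiff (E F : Finset Edge) (s : Config) :
    zChar (symmDiff E F) s = zChar E s * zChar F s := by
  have h1 : ∀ G : Finset Edge, zChar G s * zChar G s = 1 := fun G => by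
    simp only [zChar, ← Finset.prod_mul_distrib, zSign_mul_self, Finset.prod_const_one]
  have hE : zChar E s = zChar (E ∩ F) s * zChar (E \ F) s :=
    (Finset.prod_inter_mul_prod_sdiff E F _).symm
  have hF : zChar F s = zChar (E ∩ F) s * zChar (F \ E) s := by
    rw [Finset.inter_comm]
    exact (Finset.prod_inter_mul_prod_sdiff F E _).symm
  have hd : zChar (symmDiff E F) s = zChar (E \ F) s * zChar (F \ E) s := by
    rw [symmDiff_def]
    exact Finset.prod_union disjoint_sdiff_sdiff
  rw [hd, hE, hF]
  linear_combination (-(zChar (E \ F) s * zChar (F \ E) s)) * h1 (E ∩ F)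

lemma prodX_mul (E F : Finset Edge) : prodX E * prodX F = prodX (symmDiff E F) := by
  refine obs_ext fun ψ s => ?_
  rw [obs_mul_apply, prodX_apply, prodX_apply, prodX_apply, flipSet_flipSet]

lemma prodZ_mul (E F : Finset Edge) : prodZ E * prodZ F = prodZ (symmDiff E F) := by
  refine obs_ext fun ψ s => ?_
  rw [obs_mul_apply, prodZ_apply, prodZ_apply, prodZ_apply, zChar_symmDiff, mul_assoc]

lemma prodX_mul_self (E : Finset Edge) : prodX E * prodX E = 1 := by
  rw [prodX_mul, symmDiff_self, Finset.bot_eq_empty, prodX_empty]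

lemma prodZ_mul_self (E : Finset Edge) : prodZ E * prodZ E = 1 := by
  rw [prodZ_mul, symmDiff_self, Finset.bot_eq_empty, prodZ_empty]

/-- The commutation sign `(-1) ^ |E ∩ F|`. -/
noncomputable def commSign (E F : Finset Edge) : ℂ := (-1) ^ (E ∩ F).card

lemma commSign_comm (E F : Finset Edge) : commSign E F = commSign F E := by
  rw [commSign, commSign, Finset.inter_comm]

lemma commSign_mul_self (E F : Finset Edge) : commSign E F * commSign E F = 1 := by
  rw [commSign, ← pow_add, Even.neg_one_pow ⟨_, rfl⟩]

lemma zChar_flipSet (E F : Finset Edge) (s : Config) :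
    zChar F (flipSet E s) = commSign E F * zChar F s := by
  have h : ∀ e, zSign (flipSet E s e) = (if e ∈ E then -1 else 1) * zSign (s e) := fun e => by
    by_cases he : e ∈ E <;> simp [flipSet, he, zSign_add_one]
  simp only [zChar, h, Finset.prod_mul_distrib]
  congr 1
  rw [Finset.prod_ite, commSign, Finset.inter_comm, Finset.filter_mem_eq_inter]
  simp

lemma prodX_mul_prodZ (E F : Finset Edge) :
    prodX E * prodZ F = commSign E F • (prodZ F * prodX E) := by
  refine obs_ext fun ψ s => ?_
  change (prodX E * prodZ F).1 ψ s = commSign E F * (prodZ F * prodX E).1 ψ s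
  rw [obs_mul_apply, obs_mul_apply, prodX_apply, prodZ_apply, prodZ_apply, prodX_apply,
    zChar_flipSet, mul_assoc]

lemma prodZ_mul_prodX (E F : Finset Edge) :
    prodZ F * prodX E = commSign E F • (prodX E * prodZ F) := by
  rw [prodX_mul_prodZ, smul_smul, commSign_mul_self, one_smul]

lemma star_sigmaX (e : Edge) : star (sigmaX e) = sigmaX e := by
  refine Subtype.ext ?_
  change star (siteRep e _) = siteRep e _
  rw [← map_star]
  congr 1
  ext i j
  fin_cases i <;> fin_cases j <;> simp

lemma star_sigmaZ (e : Edge) : star (sigmaZ e) = sigmaZ e := by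
  refine Subtype.ext ?_
  change star (siteRep e _) = siteRep e _
  rw [← map_star]
  congr 1
  ext i j
  fin_cases i <;> fin_cases j <;> simp

lemma star_prodX (E : Finset Edge) : star (prodX E) = prodX E := by
  induction E using Finset.induction_on with
  | empty => simp [prodX_empty]
  | insert e E h ih =>
    rw [prodX_insert h, star_mul, ih, star_sigmaX, ← prodX_singleton, prodX_mul, prodX_mul,
      symmDiff_comm]

lemma star_prodZ (E : Finset Edge) : star (prodZ E) = prodZ E := by
  induction E using Finset.induction_on with
  | empty => simp [prodZ_empty]
  | insert e E h ih =>
    rw [prodZ_insert h, star_mul, ih, star_sigmaZ, ← prodZ_singleton, prodZ_mul, prodZ_mul,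
      symmDiff_comm]

/-! ## Density of the Pauli monomials -/

theorem isClosed_quasiLocal : IsClosed (quasiLocal : Set (Hilb →L[ℂ] Hilb)) :=
  StarSubalgebra.isClosed_topologicalClosure _

lemma siteRep_eq (e : Edge) (M : Matrix (Fin 2) (Fin 2) ℂ) :
    (⟨siteRep e M, siteRep_mem e M⟩ : Obs) =
      ((M 0 0 + M 1 1) / 2) • (1 : Obs) + ((M 0 0 - M 1 1) / 2) • sigmaZ e +
      ((M 0 1 + M 1 0) / 2) • sigmaX e + ((M 0 1 - M 1 0) / 2) • (sigmaZ e * sigmaX e) := by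
  refine obs_ext fun ψ s => ?_
  change siteOp e M ψ s = ((M 0 0 + M 1 1) / 2) * ψ s + ((M 0 0 - M 1 1) / 2) * (sigmaZ e).1 ψ s +
    ((M 0 1 + M 1 0) / 2) * (sigmaX e).1 ψ s +
    ((M 0 1 - M 1 0) / 2) * (sigmaZ e).1 ((sigmaX e).1 ψ) s
  rw [siteOp_apply, sigmaZ_apply, sigmaZ_apply, sigmaX_apply]
  generalize ψ (flipAt e s) = x
  generalize ψ s = y
  generalize s e = a
  fin_cases a <;> simp [zSign] <;> ring

attribute [local instance] isClosed_quasiLocal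

/-- A closed star subalgebra containing the Pauli matrices contains all quasi-local observables. -/
theorem mem_of_isClosed {A : StarSubalgebra ℂ Obs} (hA : IsClosed (A : Set Obs))
    (hX : ∀ e, sigmaX e ∈ A) (hZ : ∀ e, sigmaZ e ∈ A) (O : Obs) : O ∈ A := by
  have hB : IsClosed ((A.map quasiLocal.subtype : StarSubalgebra ℂ (Hilb →L[ℂ] Hilb)) :
      Set (Hilb →L[ℂ] Hilb)) := by
    have := isClosed_quasiLocal.isClosedEmbedding_subtypeVal.isClosedMap _ hA
    exact this
  have hle : quasiLocal ≤ A.map quasiLocal.subtype := by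
    refine StarSubalgebra.topologicalClosure_minimal ?_ hB
    refine iSup_le fun Λ => iSup₂_le fun e _ => ?_
    rintro _ ⟨M, rfl⟩
    refine ⟨⟨siteRep e M, siteRep_mem e M⟩, ?_, rfl⟩
    have := add_mem (add_mem (add_mem (A.smul_mem A.one_mem ((M 0 0 + M 1 1) / 2))
      (A.smul_mem (hZ e) ((M 0 0 - M 1 1) / 2))) (A.smul_mem (hX e) ((M 0 1 + M 1 0) / 2)))
      (A.smul_mem (A.mul_mem (hZ e) (hX e)) ((M 0 1 - M 1 0) / 2))
    rw [← siteRep_eq] at this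
    exact this
  obtain ⟨P, hP, h⟩ := hle O.2
  rwa [← Subtype.ext (a1 := P) (a2 := O) h]

/-- The linear span of the Pauli monomials, as a star subalgebra. -/
noncomputable def pauliSpan : StarSubalgebra ℂ Obs where
  toSubalgebra := Submodule.toSubalgebra
    (Submodule.span ℂ (Set.range fun p : Finset Edge × Finset Edge => prodX p.1 * prodZ p.2))
    (Submodule.subset_span ⟨(∅, ∅), by simp [prodX_empty, prodZ_empty]⟩)
    (fun x y hx hy => by
      induction hx using Submodule.span_induction with
      | mem x hx =>
        obtain ⟨⟨E, F⟩, rfl⟩ := hx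
        induction hy using Submodule.span_induction with
        | mem y hy =>
          obtain ⟨⟨E', F'⟩, rfl⟩ := hy
          have : prodX E * prodZ F * (prodX E' * prodZ F') =
              commSign E' F • (prodX (symmDiff E E') * prodZ (symmDiff F F')) := by
            rw [mul_assoc, ← mul_assoc (prodZ F), prodZ_mul_prodX, smul_mul_assoc,
              mul_smul_comm, mul_assoc (prodX E'), prodZ_mul, ← mul_assoc, prodX_mul]
          simp only [this]
          exact Submodule.smul_mem _ _ (Submodule.subset_span ⟨(_, _), rfl⟩)
        | zero => rw [mul_zero]; exact zero_mem _
        | add y z _ _ h1 h2 => rw [mul_add]; exact add_mem h1 h2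
        | smul c y _ h => rw [mul_smul_comm]; exact Submodule.smul_mem _ _ h
      | zero => rw [zero_mul]; exact zero_mem _
      | add x z _ _ h1 h2 => rw [add_mul]; exact add_mem h1 h2
      | smul c x _ h => rw [smul_mul_assoc]; exact Submodule.smul_mem _ _ h)
  star_mem' := fun {x} hx => by
    change x ∈ Submodule.span ℂ _ at hx
    change star x ∈ Submodule.span ℂ _
    induction hx using Submodule.span_induction with
    | mem x hx =>
      obtain ⟨⟨E, F⟩, rfl⟩ := hx
      simp only [star_mul, star_prodX, star_prodZ, prodZ_mul_prodX]
      exact Submodule.smul_mem _ _ (Submodule.subset_span ⟨(_, _), rfl⟩)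
    | zero => rw [star_zero]; exact zero_mem _
    | add y z _ _ h1 h2 => rw [star_add]; exact add_mem h1 h2
    | smul c y _ h => rw [star_smul]; exact Submodule.smul_mem _ _ h

lemma prodX_mul_prodZ_mem_pauliSpan (E F : Finset Edge) : prodX E * prodZ F ∈ pauliSpan :=
  Submodule.subset_span ⟨(E, F), rfl⟩

/-- Continuous linear functionals agreeing on the Pauli monomials are equal. -/
theorem functional_ext {f g : Obs →ₗ[ℂ] ℂ} (hf : Continuous f) (hg : Continuous g)
    (h : ∀ E F, f (prodX E * prodZ F) = g (prodX E * prodZ F)) : f = g := by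
  refine LinearMap.ext fun O => ?_
  have hO : O ∈ pauliSpan.topologicalClosure := by
    refine mem_of_isClosed (StarSubalgebra.isClosed_topologicalClosure _) (fun e => ?_)
      (fun e => ?_) O
    · refine StarSubalgebra.le_topologicalClosure _ ?_
      simpa [prodX_singleton, prodZ_empty] using prodX_mul_prodZ_mem_pauliSpan {e} ∅
    · refine StarSubalgebra.le_topologicalClosure _ ?_
      simpa [prodZ_singleton, prodX_empty] using prodX_mul_prodZ_mem_pauliSpan ∅ {e}
  have hs : (pauliSpan : Set Obs) ⊆ {O | f O = g O} := by
    intro O hO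
    change O ∈ Submodule.span ℂ _ at hO
    refine LinearMap.eqOn_span (f := f) (g := g) ?_ hO
    rintro _ ⟨⟨E, F⟩, rfl⟩
    exact h E F
  exact closure_minimal hs (isClosed_eq hf hg) hO

/-! ## States -/

section PositiveMap

variable {A : Type*} [CStarAlgebra A] {ω : A →ₗ[ℂ] ℂ} (h : ∀ a, 0 ≤ ω (star a * a))

attribute [local instance] CStarAlgebra.spectralOrder CStarAlgebra.spectralOrderedRing

/-- A positive functional as a bundled positive linear map, for the spectral order. -/
noncomputable def positiveOfNonneg : A →ₚ[ℂ] ℂ :=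
  PositiveLinearMap.mk₀ ω fun x hx => by
    obtain ⟨b, rfl⟩ := CStarAlgebra.nonneg_iff_eq_star_mul_self.mp hx
    exact h b

include h

lemma continuous_of_nonneg : Continuous ω :=
  map_continuous (positiveOfNonneg h)

lemma star_mul_eq_zero_of_nonneg {a : A} (ha : ω (star a * a) = 0) (b : A) :
    ω (star a * b) = 0 ∧ ω (b * a) = 0 := by
  have h0 : ‖(positiveOfNonneg h).toPreGNS a‖ = 0 := by
    rw [PositiveLinearMap.preGNS_norm_def]
    change √(ω (star a * a)).re = 0
    simp [ha]
  constructor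
  · have := norm_inner_le_norm (𝕜 := ℂ) ((positiveOfNonneg h).toPreGNS a)
      ((positiveOfNonneg h).toPreGNS b)
    rw [h0, zero_mul] at this
    exact norm_le_zero_iff.mp this
  · have := norm_inner_le_norm (𝕜 := ℂ) ((positiveOfNonneg h).toPreGNS (star b))
      ((positiveOfNonneg h).toPreGNS a)
    rw [h0, mul_zero, PositiveLinearMap.preGNS_inner_def] at this
    simp only [PositiveLinearMap.ofPreGNS_toPreGNS, star_star] at this
    exact norm_le_zero_iff.mp this

end PositiveMap

lemma star_one_sub_mul {U : Obs} (hs : star U = U) (hu : U * U = 1) :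
    star (1 - U) * (1 - U) = (2 : ℂ) • (1 - U) := by
  rw [star_sub, star_one, hs, sub_mul, mul_sub, mul_sub, hu, two_smul]
  simp only [one_mul, mul_one]
  abel

/-- A self-adjoint unitary with expectation value one can be absorbed. -/
lemma IsState.absorb {ω : Obs →ₗ[ℂ] ℂ} (h : IsState ω) {U : Obs} (hs : star U = U)
    (hu : U * U = 1) (h1 : ω U = 1) (O : Obs) : ω (U * O) = ω O ∧ ω (O * U) = ω O := by
  have h0 : ω (star (1 - U) * (1 - U)) = 0 := by
    rw [star_one_sub_mul hs hu, map_smul, map_sub, h.map_one, h1, sub_self, smul_zero]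
  obtain ⟨ha, hb⟩ := star_mul_eq_zero_of_nonneg h.nonneg h0 O
  rw [star_sub, star_one, hs, sub_mul, one_mul, map_sub, sub_eq_zero] at ha
  rw [mul_sub, mul_one, map_sub, sub_eq_zero] at hb
  exact ⟨ha.symm, hb.symm⟩

lemma IsState.apply_le_one {ω : Obs →ₗ[ℂ] ℂ} (h : IsState ω) {U : Obs} (hs : star U = U)
    (hu : U * U = 1) : ω U ≤ 1 := by
  have := h.nonneg (1 - U)
  rw [star_one_sub_mul hs hu, map_smul, map_sub, h.map_one, smul_eq_mul] at this
  rw [Complex.le_def] at this ⊢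
  simp at this ⊢
  exact ⟨this.1, this.2⟩

lemma eq_one_of_mem_openSegment {x y : ℂ} (hx : x ≤ 1) (hy : y ≤ 1) {a b : ℝ} (ha : 0 < a)
    (hb : 0 < b) (hab : a + b = 1) (h : a • x + b • y = 1) : x = 1 := by
  rw [Complex.le_def] at hx hy
  have hre := congrArg Complex.re h
  simp at hx hy hre
  refine Complex.ext ?_ (by simpa using hx.2)
  simp only [Complex.one_re]
  nlinarith

/-- A state which is the only vacuum is pure. -/
theorem isPure_of_unique {ω : Obs →ₗ[ℂ] ℂ} (hω : ∀ ω', IsVacuum ω' ↔ ω' = ω) : IsPure ω := by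
  have h := (hω ω).mpr rfl
  refine mem_extremePoints_iff_left.mpr ⟨h.isState, fun φ₁ h₁ φ₂ h₂ ⟨a, b, ha, hb, hab, hseg⟩ => ?_⟩
  have key : ∀ U : Obs, star U = U → U * U = 1 → ω U = 1 → φ₁ U = 1 := fun U hs hu h1 => by
    refine eq_one_of_mem_openSegment (IsState.apply_le_one h₁ hs hu) (IsState.apply_le_one h₂ hs hu)
      ha hb hab ?_
    rw [← h1, ← hseg]
    rfl
  exact (hω φ₁).mp ⟨h₁, fun v => key _ (star_prodX _) (prodX_mul_self _) (h.star_eq_one v),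
    fun f => key _ (star_prodZ _) (prodZ_mul_self _) (h.face_eq_one f)⟩

lemma IsState.pullback {ω : Obs →ₗ[ℂ] ℂ} (h : IsState ω) (α : Obs ≃⋆ₐ[ℂ] Obs) :
    IsState (pullback ω α) where
  nonneg O := by
    change 0 ≤ ω (α (star O * O))
    rw [map_mul, map_star]
    exact h.nonneg _
  map_one := by
    change ω (α 1) = 1
    rw [_root_.map_one α, h.map_one]

lemma pullback_symm_pullback (ω : Obs →ₗ[ℂ] ℂ) (α : Obs ≃⋆ₐ[ℂ] Obs) :
    pullback (pullback ω α) α.symm = ω :=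
  LinearMap.ext fun O => congrArg ω (α.apply_symm_apply O)

lemma pullback_pullback_symm (ω : Obs →ₗ[ℂ] ℂ) (α : Obs ≃⋆ₐ[ℂ] Obs) :
    pullback (pullback ω α.symm) α = ω :=
  LinearMap.ext fun O => congrArg ω (α.symm_apply_apply O)

/-- Composing a pure state with an automorphism gives a pure state. -/
theorem IsPure.pullback {ω : Obs →ₗ[ℂ] ℂ} (h : IsPure ω) (α : Obs ≃⋆ₐ[ℂ] Obs) :
    IsPure (pullback ω α) := by
  obtain ⟨h1, h2⟩ := mem_extremePoints_iff_left.mp h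
  refine mem_extremePoints_iff_left.mpr ⟨IsState.pullback h1 α,
    fun φ₁ h₁ φ₂ h₂ ⟨a, b, ha, hb, hab, hseg⟩ => ?_⟩
  have := h2 _ (IsState.pullback h₁ α.symm) _ (IsState.pullback h₂ α.symm)
    ⟨a, b, ha, hb, hab, by rw [← pullback_symm_pullback ω α, ← hseg]; rfl⟩
  rw [← this, pullback_pullback_symm]

/-! ## Limits of inner automorphisms -/

section Limit

variable {U : ℕ → Obs} (hs : ∀ n, star (U n) = U n) (hu : ∀ n, U n * U n = 1)

include hs hu

lemma norm_conj_eq (n : ℕ) (O : Obs) : ‖U n * O * U n‖ = ‖O‖ := by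
  have hU : U n ∈ unitary Obs := ⟨by rw [hs, hu], by rw [hs, hu]⟩
  rw [CStarRing.norm_mul_mem_unitary _ hU, CStarRing.norm_mem_unitary_mul _ hU]

/-- The observables on which the conjugations by `U n` converge. -/
noncomputable def convergenceAlgebra : StarSubalgebra ℂ Obs where
  carrier := {O | ∃ P, Tendsto (fun n => U n * O * U n) atTop (𝓝 P)}
  mul_mem' := by
    rintro O O' ⟨P, hP⟩ ⟨P', hP'⟩
    refine ⟨P * P', (hP.mul hP').congr fun n => ?_⟩
    calc U n * O * U n * (U n * O' * U n) = U n * O * (U n * U n) * O' * U n := by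
          simp only [mul_assoc]
      _ = U n * (O * O') * U n := by rw [hu, mul_one]; simp only [mul_assoc]
  add_mem' := by
    rintro O O' ⟨P, hP⟩ ⟨P', hP'⟩
    exact ⟨P + P', (hP.add hP').congr fun n => by rw [mul_add, add_mul]⟩
  algebraMap_mem' c := by
    refine ⟨algebraMap ℂ Obs c, tendsto_const_nhds.congr fun n => ?_⟩
    rw [← Algebra.commutes, mul_assoc, hu, mul_one]
  star_mem' := by
    rintro O ⟨P, hP⟩
    refine ⟨star P, hP.star.congr fun n => ?_⟩
    rw [star_mul, star_mul, hs, mul_assoc]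

lemma isClosed_convergenceAlgebra : IsClosed (convergenceAlgebra hs hu : Set Obs) := by
  refine isClosed_of_closure_subset fun O hO => ?_
  refine cauchySeq_tendsto_of_complete (Metric.cauchySeq_iff'.mpr fun ε hε => ?_)
  obtain ⟨P, ⟨Q, hQ⟩, hP⟩ := Metric.mem_closure_iff.mp hO (ε / 3) (by positivity)
  obtain ⟨N, hN⟩ := Metric.cauchySeq_iff'.mp hQ.cauchySeq (ε / 3) (by positivity)
  have hd : ∀ n, dist (U n * O * U n) (U n * P * U n) < ε / 3 := fun n => by
    rw [dist_eq_norm, ← sub_mul, ← mul_sub, norm_conj_eq hs hu, ← dist_eq_norm]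
    exact hP
  refine ⟨N, fun n hn => ?_⟩
  have h1 := dist_triangle4 (U n * O * U n) (U n * P * U n) (U N * P * U N) (U N * O * U N)
  have h2 := hd N
  rw [dist_comm] at h2
  linarith [hd n, hN n hn]

/-- If conjugation by self-adjoint unitaries converges on the Pauli matrices, then it converges
everywhere, and the limit is an automorphism. -/
theorem existsUnique_limitAut
    (hX : ∀ e, ∃ P, Tendsto (fun n => U n * sigmaX e * U n) atTop (𝓝 P))
    (hZ : ∀ e, ∃ P, Tendsto (fun n => U n * sigmaZ e * U n) atTop (𝓝 P)) :
    ∃! α : Obs ≃⋆ₐ[ℂ] Obs, ∀ O : Obs, Tendsto (fun n => U n * O * U n) atTop (𝓝 (α O)) := by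
  have hlim : ∀ O, ∃ P, Tendsto (fun n => U n * O * U n) atTop (𝓝 P) := fun O =>
    mem_of_isClosed (isClosed_convergenceAlgebra hs hu) hX hZ O
  choose L hL using hlim
  have hinv : ∀ O, L (L O) = O := fun O => by
    refine tendsto_nhds_unique (hL (L O)) (tendsto_iff_norm_sub_tendsto_zero.mpr ?_)
    refine (tendsto_iff_norm_sub_tendsto_zero.mp (hL O)).congr fun n => ?_
    have h : U n * (U n * O * U n) * U n = O := by
      calc _ = (U n * U n) * O * (U n * U n) := by simp only [mul_assoc]
        _ = O := by rw [hu, one_mul, mul_one]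
    rw [← norm_conj_eq hs hu n, mul_sub, sub_mul, h, norm_sub_rev]
  refine ⟨{ toFun := L
            invFun := L
            left_inv := hinv
            right_inv := hinv
            map_mul' := fun O O' => tendsto_nhds_unique (hL _) (((hL O).mul (hL O')).congr fun n => ?_)
            map_add' := fun O O' => tendsto_nhds_unique (hL _) (((hL O).add (hL O')).congr fun n => ?_)
            map_star' := fun O => tendsto_nhds_unique (hL _) ((hL O).star.congr fun n => ?_)
            map_smul' := fun c O => tendsto_nhds_unique (hL _) (((hL O).const_smul c).congr fun n => ?_) },
    hL, fun β hβ => StarAlgEquiv.ext fun O => tendsto_nhds_unique (hβ O) (hL O)⟩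
  · calc U n * O * U n * (U n * O' * U n) = U n * O * (U n * U n) * O' * U n := by
          simp only [mul_assoc]
      _ = U n * (O * O') * U n := by rw [hu, mul_one]; simp only [mul_assoc]
  · rw [mul_add, add_mul]
  · rw [star_mul, star_mul, hs, mul_assoc]
  · rw [mul_smul_comm, smul_mul_assoc]

end Limit

lemma eventually_const_mem {E : ℕ → Finset Edge} (hE : Monotone E) (e : Edge) :
    ∃ p : Prop, ∀ᶠ n in atTop, (e ∈ E n ↔ p) := by
  by_cases h : ∃ n, e ∈ E n
  · obtain ⟨n, hn⟩ := h
    exact ⟨True, eventually_atTop.mpr ⟨n, fun m hm => iff_true_intro (hE hm hn)⟩⟩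
  · exact ⟨False, Eventually.of_forall fun n => iff_false_intro fun hn => h ⟨n, hn⟩⟩

lemma commSign_singleton_left (e : Edge) (E : Finset Edge) [Decidable (e ∈ E)] :
    commSign {e} E = if e ∈ E then -1 else 1 := by
  by_cases h : e ∈ E <;> simp [commSign, h]

lemma tendsto_commSign {E : ℕ → Finset Edge} (hE : Monotone E) (e : Edge) (O : Obs) :
    ∃ P, Tendsto (fun n => commSign {e} (E n) • O) atTop (𝓝 P) := by
  classical
  obtain ⟨p, hp⟩ := eventually_const_mem hE e
  refine ⟨(if p then (-1 : ℂ) else 1) • O, tendsto_const_nhds.congr' ?_⟩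
  filter_upwards [hp] with n hn
  simp only [commSign_singleton_left, hn]

lemma existsUnique_prodZ_limit {E : ℕ → Finset Edge} (hE : Monotone E) :
    ∃! α : Obs ≃⋆ₐ[ℂ] Obs,
      ∀ O : Obs, Tendsto (fun n => prodZ (E n) * O * prodZ (E n)) atTop (𝓝 (α O)) := by
  refine existsUnique_limitAut (fun n => star_prodZ _) (fun n => prodZ_mul_self _)
    (fun e => ?_) (fun e => ⟨sigmaZ e, tendsto_const_nhds.congr fun n => ?_⟩)
  · obtain ⟨P, hP⟩ := tendsto_commSign hE e (sigmaX e)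
    refine ⟨P, hP.congr fun n => ?_⟩
    rw [← prodX_singleton, prodZ_mul_prodX, smul_mul_assoc, mul_assoc, prodZ_mul_self, mul_one]
  · rw [← prodZ_singleton, prodZ_mul, symmDiff_comm, ← prodZ_mul, mul_assoc, prodZ_mul_self,
      mul_one]

lemma existsUnique_prodX_limit {E : ℕ → Finset Edge} (hE : Monotone E) :
    ∃! α : Obs ≃⋆ₐ[ℂ] Obs,
      ∀ O : Obs, Tendsto (fun n => prodX (E n) * O * prodX (E n)) atTop (𝓝 (α O)) := by
  refine existsUnique_limitAut (fun n => star_prodX _) (fun n => prodX_mul_self _)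
    (fun e => ⟨sigmaX e, tendsto_const_nhds.congr fun n => ?_⟩) (fun e => ?_)
  · rw [← prodX_singleton, prodX_mul, symmDiff_comm, ← prodX_mul, mul_assoc, prodX_mul_self,
      mul_one]
  · obtain ⟨P, hP⟩ := tendsto_commSign hE e (sigmaZ e)
    refine ⟨P, hP.congr fun n => ?_⟩
    rw [← prodZ_singleton, prodX_mul_prodZ, smul_mul_assoc, mul_assoc, prodX_mul_self, mul_one,
      commSign_comm]

lemma downPath_mono (v : Vertex) : Monotone (downPath v) := fun _ _ h =>
  Finset.image_subset_image (Finset.range_mono h)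

theorem existsUnique_chargeAut (v : Vertex) : ∃! α : Obs ≃⋆ₐ[ℂ] Obs, IsChargeAut v α :=
  existsUnique_prodZ_limit (downPath_mono v)

theorem existsUnique_fluxAut {S : ℕ → Finset Face} (hS : Monotone S) :
    ∃! β : Obs ≃⋆ₐ[ℂ] Obs, IsFluxAut S β :=
  existsUnique_prodX_limit fun _ _ h => Finset.image_subset_image (hS h)

/-! ## Existence of a vacuum -/

/-- The coboundary (mod 2) of the indicator function of a set of vertices. -/
def coboundaryConfig (T : Finset Vertex) : Config := fun e =>
  (if e.base ∈ T then 1 else 0) + (if e.base + unit e.dir ∈ T then 1 else 0)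

lemma unit_ne_zero (r : Fin 3) : unit r ≠ 0 := by
  simp [unit]

lemma mem_starEdges {e : Edge} {v : Vertex} :
    e ∈ starEdges v ↔ e.base = v ∨ e.base + unit e.dir = v := by
  simp only [starEdges, Finset.mem_biUnion, Finset.mem_univ, true_and, Finset.mem_insert,
    Finset.mem_singleton]
  constructor
  · rintro ⟨r, rfl | rfl⟩ <;> simp
  · rintro (h | h)
    · exact ⟨e.dir, Or.inl (Edge.ext h rfl)⟩
    · exact ⟨e.dir, Or.inr (Edge.ext (by simp [← h]) rfl)⟩

lemma ite_mem_symmDiff_singleton (T : Finset Vertex) (v w : Vertex) :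
    (if w ∈ symmDiff T {v} then (1 : Fin 2) else 0) =
      (if w ∈ T then 1 else 0) + (if w = v then 1 else 0) := by
  by_cases h2 : w = v
  · subst h2
    by_cases h1 : w ∈ T <;> simp [Finset.mem_symmDiff, h1]
  · by_cases h1 : w ∈ T <;> simp [Finset.mem_symmDiff, h1, h2]

lemma flipSet_coboundaryConfig (v : Vertex) (T : Finset Vertex) :
    flipSet (starEdges v) (coboundaryConfig T) = coboundaryConfig (symmDiff T {v}) := by
  funext e
  have hne : ¬ (e.base = v ∧ e.base + unit e.dir = v) := fun ⟨h1, h2⟩ =>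
    unit_ne_zero e.dir (by rw [h1] at h2; simpa using h2)
  simp only [flipSet, mem_starEdges, coboundaryConfig, ite_mem_symmDiff_singleton]
  generalize (if e.base ∈ T then (1 : Fin 2) else 0) = a
  generalize (if e.base + unit e.dir ∈ T then (1 : Fin 2) else 0) = b
  by_cases h1 : e.base = v <;> by_cases h2 : e.base + unit e.dir = v
  · exact absurd ⟨h1, h2⟩ hne
  · simp [h1, unit_ne_zero]; abel
  · simp [h1, h2]; abel
  · simp [h1, h2]

lemma fin_three_add_one_ne_add_two (r : Fin 3) : r + 1 ≠ r + 2 := by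
  revert r; decide

@[to_additive]
lemma prod_face_edges {M : Type*} [CommMonoid M] (f : Face) (g : Edge → M) :
    ∏ e ∈ f.edges, g e =
      g ⟨f.base, f.normal + 1⟩ * (g ⟨f.base + unit (f.normal + 2), f.normal + 1⟩ *
        (g ⟨f.base, f.normal + 2⟩ * g ⟨f.base + unit (f.normal + 1), f.normal + 2⟩)) := by
  have h1 := fin_three_add_one_ne_add_two f.normal
  rw [Face.edges, Finset.prod_insert, Finset.prod_insert, Finset.prod_insert,
    Finset.prod_singleton]
  all_goals simp [h1, unit_ne_zero]

lemma zChar_coboundaryConfig (f : Face) (T : Finset Vertex) :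
    zChar f.edges (coboundaryConfig T) = 1 := by
  have hsq := fun v => zSign_mul_self (if v ∈ T then 1 else 0)
  rw [zChar, prod_face_edges]
  simp only [coboundaryConfig, zSign_add]
  rw [add_right_comm f.base (unit (f.normal + 2)) (unit (f.normal + 1))]
  have ha := hsq f.base
  have hb := hsq (f.base + unit (f.normal + 1))
  have hc := hsq (f.base + unit (f.normal + 2))
  have hd := hsq (f.base + unit (f.normal + 1) + unit (f.normal + 2))
  generalize zSign (if f.base ∈ T then 1 else 0) = a at *
  generalize zSign (if f.base + unit (f.normal + 1) ∈ T then 1 else 0) = b at *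
  generalize zSign (if f.base + unit (f.normal + 2) ∈ T then 1 else 0) = c at *
  generalize zSign (if f.base + unit (f.normal + 1) + unit (f.normal + 2) ∈ T then 1 else 0) = d
    at *
  linear_combination (b * b * c * c * d * d) * ha + (c * c * d * d) * hb + (d * d) * hc + hd

open Classical in
/-- The configurations which are coboundaries of subsets of `V`. -/
noncomputable def coboundaryConfigs (V : Finset Vertex) : Finset Config :=
  V.powerset.image coboundaryConfig

lemma mem_coboundaryConfigs_flipSet {V : Finset Vertex} {v : Vertex} (hv : v ∈ V) {s : Config}
    (h : s ∈ coboundaryConfigs V) : flipSet (starEdges v) s ∈ coboundaryConfigs V := by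
  classical
  simp only [coboundaryConfigs, Finset.mem_image, Finset.mem_powerset] at h ⊢
  obtain ⟨T, hT, rfl⟩ := h
  refine ⟨symmDiff T {v}, fun w hw => ?_, (flipSet_coboundaryConfig v T).symm⟩
  rw [Finset.mem_symmDiff] at hw
  rcases hw with hw | hw
  · exact hT hw.1
  · rwa [Finset.mem_singleton.mp hw.1]

lemma mem_coboundaryConfigs_flipSet_iff {V : Finset Vertex} {v : Vertex} (hv : v ∈ V)
    (s : Config) : flipSet (starEdges v) s ∈ coboundaryConfigs V ↔ s ∈ coboundaryConfigs V := by
  refine ⟨fun h => ?_, mem_coboundaryConfigs_flipSet hv⟩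
  have := mem_coboundaryConfigs_flipSet hv h
  rwa [flipSet_flipSet, symmDiff_self, Finset.bot_eq_empty, flipSet_empty] at this

open Classical in
/-- The indicator function of `coboundaryConfigs V`. -/
noncomputable def vacuumVector (V : Finset Vertex) : Hilb :=
  ∑ s ∈ coboundaryConfigs V, lp.single 2 s 1

open Classical in
lemma vacuumVector_apply (V : Finset Vertex) (s : Config) :
    vacuumVector V s = if s ∈ coboundaryConfigs V then 1 else 0 := by
  rw [vacuumVector, lp.coeFn_sum, Finset.sum_apply]
  simp [lp.single_apply, Pi.single_apply]

lemma vacuumVector_ne_zero (V : Finset Vertex) : vacuumVector V ≠ 0 := by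
  classical
  intro h
  have h1 := vacuumVector_apply V (coboundaryConfig ∅)
  rw [if_pos (by
    rw [coboundaryConfigs, Finset.mem_image]
    exact ⟨∅, Finset.mem_powerset.mpr (Finset.empty_subset _), rfl⟩), h] at h1
  simp at h1

lemma starOp_vacuumVector {V : Finset Vertex} {v : Vertex} (hv : v ∈ V) :
    (starOp v).1 (vacuumVector V) = vacuumVector V := by
  classical
  ext s
  rw [starOp, prodX_apply, vacuumVector_apply, vacuumVector_apply]
  simp only [mem_coboundaryConfigs_flipSet_iff hv]

lemma faceOp_vacuumVector (V : Finset Vertex) (f : Face) :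
    (faceOp f).1 (vacuumVector V) = vacuumVector V := by
  classical
  ext s
  rw [faceOp, prodZ_apply, vacuumVector_apply]
  split_ifs with h
  · rw [coboundaryConfigs, Finset.mem_image] at h
    obtain ⟨T, -, rfl⟩ := h
    rw [zChar_coboundaryConfig, mul_one]
  · rw [mul_zero]

/-- The normalized vector `vacuumVector V`. -/
noncomputable def vacuumUnit (V : Finset Vertex) : Hilb :=
  (‖vacuumVector V‖⁻¹ : ℂ) • vacuumVector V

lemma norm_vacuumUnit (V : Finset Vertex) : ‖vacuumUnit V‖ = 1 := by
  rw [vacuumUnit, norm_smul, norm_inv, Complex.norm_real, norm_norm,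
    inv_mul_cancel₀ (norm_ne_zero_iff.mpr (vacuumVector_ne_zero V))]

lemma exists_tendsto_vacuum (O : Obs) : ∃ c : ℂ,
    Tendsto (fun V => inner ℂ (vacuumUnit V) (O.1 (vacuumUnit V)))
      (Ultrafilter.of (atTop : Filter (Finset Vertex))) (𝓝 c) := by
  have h := (isCompact_closedBall (0 : ℂ) ‖O.1‖).ultrafilter_le_nhds
    ((Ultrafilter.of (atTop : Filter (Finset Vertex))).map
      fun V => inner ℂ (vacuumUnit V) (O.1 (vacuumUnit V))) (by
    rw [le_principal_iff]
    refine Filter.mem_map.mpr (Filter.univ_mem' fun V => ?_)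
    rw [Set.mem_preimage, mem_closedBall_zero_iff]
    calc _ ≤ ‖vacuumUnit V‖ * ‖O.1 (vacuumUnit V)‖ := norm_inner_le_norm _ _
      _ ≤ ‖vacuumUnit V‖ * (‖O.1‖ * ‖vacuumUnit V‖) := by gcongr; exact O.1.le_opNorm _
      _ = ‖O.1‖ := by rw [norm_vacuumUnit, one_mul, mul_one])
  obtain ⟨c, -, hc⟩ := h
  exact ⟨c, hc⟩

theorem exists_isVacuum : ∃ ω : Obs →ₗ[ℂ] ℂ, IsVacuum ω := by
  choose L hL using exists_tendsto_vacuum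
  have hfix : ∀ (O : Obs), (∀ᶠ V in atTop, O.1 (vacuumVector V) = vacuumVector V) → L O = 1 := by
    intro O hO
    refine tendsto_nhds_unique (hL O) (tendsto_const_nhds.congr' ?_)
    filter_upwards [Ultrafilter.of_le _ hO] with V hV
    have h : O.1 (vacuumUnit V) = vacuumUnit V := by
      rw [vacuumUnit, map_smul, hV]
    rw [h, inner_self_eq_norm_sq_to_K, norm_vacuumUnit]
    simp
  refine ⟨{ toFun := L
            map_add' := fun O P => tendsto_nhds_unique (hL _)
              (((hL O).add (hL P)).congr fun V => ?_)
            map_smul' := fun c O => tendsto_nhds_unique (hL _)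
              (((hL O).const_mul c).congr fun V => ?_) }, ⟨fun O => ?_, ?_⟩, fun v => ?_, fun f => ?_⟩
  · rw [← inner_add_right]; rfl
  · rw [← inner_smul_right]; rfl
  · refine ge_of_tendsto (hL (star O * O)) (Eventually.of_forall fun V => ?_)
    have h : inner ℂ (vacuumUnit V) ((star O * O).1 (vacuumUnit V)) =
        inner ℂ (O.1 (vacuumUnit V)) (O.1 (vacuumUnit V)) := by
      change inner ℂ _ ((star O.1) (O.1 (vacuumUnit V))) = _
      rw [ContinuousLinearMap.star_eq_adjoint, ContinuousLinearMap.adjoint_inner_right]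
    rw [h, inner_self_eq_norm_sq_to_K, ← RCLike.ofReal_pow]
    exact RCLike.ofReal_nonneg.mpr (sq_nonneg _)
  · exact hfix 1 (Eventually.of_forall fun V => rfl)
  · refine hfix _ ?_
    filter_upwards [eventually_ge_atTop {v}] with V hV
    exact starOp_vacuumVector (hV (Finset.mem_singleton_self v))
  · exact hfix _ (Eventually.of_forall fun V => faceOp_vacuumVector V f)

/-! ## Homology of the lattice with finite supports -/

section Sums

variable {M : Type*} [AddCommMonoid M] (g : Edge → M)

lemma sum_face_edges_zero (b : Vertex) :
    ∑ e ∈ (⟨b, 0⟩ : Face).edges, g e =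
      g ⟨b, 1⟩ + (g ⟨b + unit 2, 1⟩ + (g ⟨b, 2⟩ + g ⟨b + unit 1, 2⟩)) :=
  sum_face_edges ⟨b, 0⟩ g

lemma sum_face_edges_one (b : Vertex) :
    ∑ e ∈ (⟨b, 1⟩ : Face).edges, g e =
      g ⟨b, 2⟩ + (g ⟨b + unit 0, 2⟩ + (g ⟨b, 0⟩ + g ⟨b + unit 2, 0⟩)) :=
  sum_face_edges ⟨b, 1⟩ g

lemma sum_face_edges_two (b : Vertex) :
    ∑ e ∈ (⟨b, 2⟩ : Face).edges, g e =
      g ⟨b, 0⟩ + (g ⟨b + unit 1, 0⟩ + (g ⟨b, 1⟩ + g ⟨b + unit 0, 1⟩)) :=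
  sum_face_edges ⟨b, 2⟩ g

lemma sum_starEdges (v : Vertex) :
    ∑ e ∈ starEdges v, g e = (g ⟨v, 0⟩ + g ⟨v - unit 0, 0⟩) +
      (g ⟨v, 1⟩ + g ⟨v - unit 1, 1⟩) + (g ⟨v, 2⟩ + g ⟨v - unit 2, 2⟩) := by
  rw [starEdges, Finset.sum_biUnion, Fin.sum_univ_three]
  · have h : ∀ r, (⟨v, r⟩ : Edge) ≠ ⟨v - unit r, r⟩ := fun r h =>
      unit_ne_zero r (by simpa using (congrArg Edge.base h).symm)
    rw [Finset.sum_pair (h 0), Finset.sum_pair (h 1), Finset.sum_pair (h 2)]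
  · intro r _ r' _ hr
    simp [Function.onFun, Finset.disjoint_left, hr]

end Sums

/-- Finite chains with coefficients in `ℤ/2`. -/
abbrev Chain : Type := Edge →₀ ZMod 2

/-- The chain of a finite set of edges. -/
noncomputable def toChain (E : Finset Edge) : Chain := ∑ e ∈ E, Finsupp.single e 1

lemma toChain_apply (E : Finset Edge) (e : Edge) : toChain E e = if e ∈ E then 1 else 0 := by
  simp [toChain, Finsupp.finsetSum_apply, Finsupp.single_apply]

lemma support_toChain (E : Finset Edge) : (toChain E).support = E := by
  ext e
  simp [toChain_apply]

lemma zmod_two_eq_one {a : ZMod 2} (h : a ≠ 0) : a = 1 := by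
  revert a; decide

lemma support_add_eq_symmDiff (c d : Chain) : (c + d).support = symmDiff c.support d.support := by
  ext e
  have h : ∀ a b : ZMod 2, a + b ≠ 0 ↔ (a ≠ 0 ∧ ¬ b ≠ 0) ∨ (b ≠ 0 ∧ ¬ a ≠ 0) := by decide
  simp only [Finset.mem_symmDiff, Finsupp.mem_support_iff, Finsupp.add_apply]
  exact h _ _

/-- The chains whose support satisfies a predicate stable under symmetric differences. -/
def chainsOfPred (p : Finset Edge → Prop) (h0 : p ∅)
    (hadd : ∀ E F, p E → p F → p (symmDiff E F)) : AddSubgroup Chain where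
  carrier := {c | p c.support}
  zero_mem' := by simpa using h0
  add_mem' := fun {c d} hc hd => by
    change p (c + d).support
    rw [support_add_eq_symmDiff]
    exact hadd _ _ hc hd
  neg_mem' := fun {c} hc => by
    change p (-c).support
    rwa [Finsupp.support_neg]

/-- The chains with even intersection with each member of a family of finite sets of edges. -/
def chainsEven {ι : Type*} (E : ι → Finset Edge) : AddSubgroup Chain where
  carrier := {c | ∀ i, ∑ e ∈ E i, c e = 0}
  zero_mem' := by simp
  add_mem' := fun {c d} hc hd i => by
    simp only [Finsupp.add_apply, Finset.sum_add_distrib]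
    rw [hc i, hd i, add_zero]
  neg_mem' := fun {c} hc i => by
    simp only [Finsupp.neg_apply, Finset.sum_neg_distrib]
    rw [hc i, neg_zero]

/-- The chains supported in a set of edges. -/
def chainsSupported (T : Set Edge) : AddSubgroup Chain where
  carrier := {c | ∀ e, e ∉ T → c e = 0}
  zero_mem' := by simp
  add_mem' := fun {c d} hc hd e he => by rw [Finsupp.add_apply, hc e he, hd e he, add_zero]
  neg_mem' := fun {c} hc e he => by rw [Finsupp.neg_apply, hc e he, neg_zero]

lemma single_mem_chainsSupported {T : Set Edge} {e : Edge} (he : e ∈ T) :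
    Finsupp.single e 1 ∈ chainsSupported T := fun e' he' => by
  rw [Finsupp.single_apply, if_neg]
  rintro rfl
  exact he' he

lemma mem_of_single_mem {K : AddSubgroup Chain} (h : ∀ e, Finsupp.single e 1 ∈ K) (c : Chain) :
    c ∈ K := by
  induction c using Finsupp.induction_linear with
  | zero => exact K.zero_mem
  | add c d hc hd => exact K.add_mem hc hd
  | single e a =>
    by_cases ha : a = 0
    · rw [ha, Finsupp.single_zero]
      exact K.zero_mem
    · rw [zmod_two_eq_one ha]
      exact h e

lemma sum_toChain (A B : Finset Edge) :
    ∑ e ∈ A, toChain B e = ((A ∩ B).card : ZMod 2) := by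
  simp [toChain_apply]

lemma sum_face_mem_star (f : Face) (v : Vertex) : ∑ e ∈ f.edges, toChain (starEdges v) e = 0 := by
  have h : ∀ e : Edge, toChain (starEdges v) e =
      (if e.base = v then 1 else 0) + (if e.base + unit e.dir = v then 1 else 0) := fun e => by
    have hne : ¬ (e.base = v ∧ e.base + unit e.dir = v) := fun ⟨h1, h2⟩ =>
      unit_ne_zero e.dir (by rw [h1] at h2; simpa using h2)
    rw [toChain_apply]
    simp only [mem_starEdges]
    by_cases h1 : e.base = v <;> by_cases h2 : e.base + unit e.dir = v
    · exact absurd ⟨h1, h2⟩ hne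
    · rw [if_pos (Or.inl h1), if_pos h1, if_neg h2, add_zero]
    · rw [if_pos (Or.inr h2), if_neg h1, if_pos h2, zero_add]
    · rw [if_neg (by tauto), if_neg h1, if_neg h2, add_zero]
  simp only [h, sum_face_edges]
  rw [add_right_comm f.base (unit (f.normal + 2)) (unit (f.normal + 1))]
  generalize (if f.base = v then (1 : ZMod 2) else 0) = a
  generalize (if f.base + unit (f.normal + 1) = v then (1 : ZMod 2) else 0) = b
  generalize (if f.base + unit (f.normal + 2) = v then (1 : ZMod 2) else 0) = c
  generalize (if f.base + unit (f.normal + 1) + unit (f.normal + 2) = v then (1 : ZMod 2)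
    else 0) = d
  revert a b c d
  decide

lemma sum_star_mem_face (f : Face) (v : Vertex) : ∑ e ∈ starEdges v, toChain f.edges e = 0 := by
  rw [sum_toChain, Finset.inter_comm, ← sum_toChain, sum_face_mem_star]

lemma iff_add_zsmul {Q : Vertex → Prop} {w : Vertex} (h : ∀ p, Q p ↔ Q (p + w)) (p : Vertex)
    (k : ℤ) : Q (p + k • w) ↔ Q p := by
  induction k using Int.induction_on with
  | zero => simp
  | succ k ih => rw [← ih, add_smul, one_smul, ← add_assoc, ← h]
  | pred k ih =>
    rw [← ih, h (p + (-(k : ℤ) - 1) • w), add_assoc, sub_smul, one_smul, sub_add_cancel]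

lemma of_unit_shift {Q : Vertex → Prop} {r : Fin 3} (h : ∀ p, Q p ↔ Q (p + unit r))
    (h0 : ∀ p, p r = 0 → Q p) (p : Vertex) : Q p :=
  (iff_add_zsmul h p (-p r)).mp (h0 _ (by simp [unit]))

/-- A finite chain which is constant along a family of rays vanishes on these rays. -/
lemma eq_zero_of_ray (c : Chain) (r : Fin 3) {w : Vertex} (hw : w ≠ 0) {P : Vertex → Prop}
    (hP : ∀ p, P p → P (p + w)) (h : ∀ p, P p → c ⟨p, r⟩ = c ⟨p + w, r⟩) {p : Vertex}
    (hp : P p) : c ⟨p, r⟩ = 0 := by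
  by_contra h0
  have hn : ∀ n : ℕ, P (p + n • w) ∧ c ⟨p + n • w, r⟩ = c ⟨p, r⟩ := fun n => by
    induction n with
    | zero => simpa using hp
    | succ n ih =>
      rw [succ_nsmul, ← add_assoc]
      exact ⟨hP _ ih.1, (h _ ih.1).symm.trans ih.2⟩
  have hinj : Function.Injective fun n : ℕ => (⟨p + n • w, r⟩ : Edge) := fun m n hmn => by
    have h1 : p + m • w = p + n • w := congrArg Edge.base hmn
    have h2 : m • w = n • w := add_left_cancel h1
    obtain ⟨i, hi⟩ := Function.ne_iff.mp hw
    have h3 := congrFun h2 i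
    simp only [Pi.smul_apply, nsmul_eq_mul] at h3
    exact_mod_cast mul_right_cancel₀ hi h3
  refine Set.infinite_range_of_injective hinj (c.support.finite_toSet.subset ?_)
  rintro _ ⟨n, rfl⟩
  exact Finsupp.mem_support_iff.mpr ((hn n).2.trans_ne h0)

lemma zmod_two_add_eq_zero {a b : ZMod 2} : a + b = 0 ↔ a = b := by
  revert a b; decide

@[simp] lemma unit_apply_self (r : Fin 3) : unit r r = 1 := by simp [unit]

lemma unit_apply_ne {r i : Fin 3} (h : i ≠ r) : unit r i = 0 := by simp [unit, h]

/-- The edges at which a chain equivalent modulo the star relations can be supported: all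
horizontal edges, and the vertical edges starting at height zero. -/
def flatEdges : Set Edge := {e | e.dir = 2 → e.base 2 = 0}

lemma cocycle_eq_zero {c : Chain} (hc : c ∈ chainsEven Face.edges)
    (hT : c ∈ chainsSupported flatEdges) : c = 0 := by
  have hz : ∀ p : Vertex, p 2 ≠ 0 → c ⟨p, 2⟩ = 0 := fun p hp => hT _ fun h => hp (h rfl)
  have hx : ∀ p : Vertex, p 2 ≠ 0 → c ⟨p, 0⟩ = c ⟨p + unit 2, 0⟩ := fun p hp => by
    have h := hc ⟨p, 1⟩
    rw [sum_face_edges_one, hz p hp, hz (p + unit 0) (by simpa [unit] using hp), zero_add,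
      zero_add, zmod_two_add_eq_zero] at h
    exact h
  have hy : ∀ p : Vertex, p 2 ≠ 0 → c ⟨p, 1⟩ = c ⟨p + unit 2, 1⟩ := fun p hp => by
    have h := hc ⟨p, 0⟩
    rw [sum_face_edges_zero, hz p hp, hz (p + unit 1) (by simpa [unit] using hp), add_zero,
      add_zero, zmod_two_add_eq_zero] at h
    exact h
  have key : ∀ r : Fin 3, (∀ p : Vertex, p 2 ≠ 0 → c ⟨p, r⟩ = c ⟨p + unit 2, r⟩) →
      ∀ p, c ⟨p, r⟩ = 0 := fun r h p => by
    rcases le_or_gt (p 2) 0 with hp | hp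
    · refine eq_zero_of_ray c r (w := -unit 2) (neg_ne_zero.mpr (unit_ne_zero 2))
        (P := fun p => p 2 ≤ 0) (fun p hp => ?_) (fun p hp => ?_) hp
      · simp; lia
      · rw [h (p + -unit 2) (by simp; lia), neg_add_cancel_right]
    · refine eq_zero_of_ray c r (w := unit 2) (unit_ne_zero 2)
        (P := fun p => 0 < p 2) (fun p hp => ?_) (fun p hp => h p hp.ne') hp
      simp; lia
  have hv : ∀ p, c ⟨p, 2⟩ = 0 := fun p => by
    refine eq_zero_of_ray c 2 (w := unit 0) (unit_ne_zero 0) (P := fun _ => True)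
      (fun _ _ => trivial) (fun p _ => ?_) trivial
    have h := hc ⟨p, 1⟩
    rw [sum_face_edges_one, key 0 hx, key 0 hx, add_zero, add_zero, zmod_two_add_eq_zero] at h
    exact h
  ext ⟨p, r⟩
  fin_cases r
  · exact key 0 hx p
  · exact key 1 hy p
  · exact hv p

lemma toChain_starEdges (v : Vertex) : toChain (starEdges v) =
    (Finsupp.single ⟨v, 0⟩ 1 + Finsupp.single ⟨v - unit 0, 0⟩ 1) +
      (Finsupp.single ⟨v, 1⟩ 1 + Finsupp.single ⟨v - unit 1, 1⟩ 1) +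
      (Finsupp.single ⟨v, 2⟩ 1 + Finsupp.single ⟨v - unit 2, 2⟩ 1) :=
  sum_starEdges _ v

lemma single_mem_sup_flat {H : AddSubgroup Chain} (hH : ∀ v, toChain (starEdges v) ∈ H)
    (e : Edge) : Finsupp.single e 1 ∈ H ⊔ chainsSupported flatEdges := by
  set K := H ⊔ chainsSupported flatEdges
  have hflat : ∀ {e : Edge}, e ∈ flatEdges → Finsupp.single e 1 ∈ K := fun he =>
    AddSubgroup.mem_sup_right (single_mem_chainsSupported he)
  obtain ⟨p, r⟩ := e
  by_cases hr : r = 2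
  · subst hr
    refine of_unit_shift (Q := fun p => Finsupp.single (⟨p, 2⟩ : Edge) (1 : ZMod 2) ∈ K) (r := 2)
      (fun p => ?_) (fun p hp => hflat fun _ => hp) p
    have h : toChain (starEdges (p + unit 2)) ∈ K := AddSubgroup.mem_sup_left (hH _)
    rw [toChain_starEdges, add_sub_cancel_right] at h
    have hh : ∀ (q : Vertex) (r : Fin 3), r ≠ 2 → Finsupp.single (⟨q, r⟩ : Edge) (1 : ZMod 2) ∈ K :=
      fun q r hr => hflat fun h => absurd h hr
    rw [K.add_mem_cancel_left (K.add_mem (K.add_mem (hh _ _ (by decide)) (hh _ _ (by decide)))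
      (K.add_mem (hh _ _ (by decide)) (hh _ _ (by decide))))] at h
    exact ⟨fun h1 => (K.add_mem_cancel_right h1).mp h, fun h1 => (K.add_mem_cancel_left h1).mp h⟩
  · exact hflat fun h => absurd h hr

/-- Every finite set of edges meeting all faces evenly is generated by vertex stars. -/
theorem cocycle_induction {p : Finset Edge → Prop} (h0 : p ∅)
    (hadd : ∀ E F, p E → p F → p (symmDiff E F)) (hstar : ∀ v, p (starEdges v))
    {E : Finset Edge} (hE : ∀ f : Face, Even (E ∩ f.edges).card) : p E := by
  set Z := chainsEven Face.edges
  set H := chainsOfPred p h0 hadd ⊓ Z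
  have hH : ∀ v, toChain (starEdges v) ∈ H := fun v => by
    refine ⟨?_, fun f => sum_face_mem_star f v⟩
    change p (toChain (starEdges v)).support
    rw [support_toChain]
    exact hstar v
  have hZ : toChain E ∈ Z := fun f => by
    rw [sum_toChain, Finset.inter_comm]
    exact (ZMod.natCast_eq_zero_iff_even).mpr (hE f)
  obtain ⟨c, hc, t, ht, hct⟩ := AddSubgroup.mem_sup.mp
    (mem_of_single_mem (single_mem_sup_flat hH) (toChain E))
  have : t = 0 := by
    refine cocycle_eq_zero ?_ ht
    rw [← hct] at hZ
    exact (Z.add_mem_cancel_left hc.2).mp hZ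
  rw [this, add_zero] at hct
  have h1 : p c.support := hc.1
  rwa [hct, support_toChain] at h1

/-- A spanning tree of the lattice. -/
def treeEdges : Set Edge :=
  {e | (e.dir ≠ 2 → e.base 2 = 0) ∧ (e.dir = 0 → e.base 1 = 0)}

lemma eq_zero_of_shift (c : Chain) (r : Fin 3)
    (h : ∀ p : Vertex, p r ≠ 0 → c ⟨p, r⟩ = c ⟨p - unit r, r⟩) (p : Vertex) : c ⟨p, r⟩ = 0 := by
  rcases lt_or_ge (p r) 0 with hp | hp
  · refine eq_zero_of_ray c r (w := -unit r) (neg_ne_zero.mpr (unit_ne_zero r))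
      (P := fun p => p r < 0) (fun p hp => ?_) (fun p hp => ?_) hp
    · simp; lia
    · rw [h p hp.ne, sub_eq_add_neg]
  · refine eq_zero_of_ray c r (w := unit r) (unit_ne_zero r)
      (P := fun p => 0 ≤ p r) (fun p hp => ?_) (fun p hp => ?_) hp
    · simp; lia
    · rw [h (p + unit r) (by simp; lia), add_sub_cancel_right]

lemma cycle_eq_zero {c : Chain} (hc : c ∈ chainsEven starEdges)
    (hT : c ∈ chainsSupported treeEdges) : c = 0 := by
  have hs : ∀ p, (c ⟨p, 0⟩ + c ⟨p - unit 0, 0⟩) + (c ⟨p, 1⟩ + c ⟨p - unit 1, 1⟩) +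
      (c ⟨p, 2⟩ + c ⟨p - unit 2, 2⟩) = 0 := fun p => by rw [← sum_starEdges, hc p]
  have h02 : ∀ p : Vertex, p 2 ≠ 0 → c ⟨p, 0⟩ = 0 := fun p hp =>
    hT _ fun h => hp (h.1 (by decide : (0 : Fin 3) ≠ 2))
  have h12 : ∀ p : Vertex, p 2 ≠ 0 → c ⟨p, 1⟩ = 0 := fun p hp =>
    hT _ fun h => hp (h.1 (by decide : (1 : Fin 3) ≠ 2))
  have h01 : ∀ p : Vertex, p 1 ≠ 0 → c ⟨p, 0⟩ = 0 := fun p hp =>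
    hT _ fun h => hp (h.2 rfl)
  have hz : ∀ p, c ⟨p, 2⟩ = 0 := eq_zero_of_shift c 2 fun p hp => by
    have h := hs p
    rw [h02 p hp, h02 _ (by simpa [unit] using hp), h12 p hp, h12 _ (by simpa [unit] using hp)] at h
    simpa [zmod_two_add_eq_zero] using h
  have hy : ∀ p, c ⟨p, 1⟩ = 0 := eq_zero_of_shift c 1 fun p hp => by
    have h := hs p
    rw [h01 p hp, h01 _ (by simpa [unit] using hp), hz, hz] at h
    simpa [zmod_two_add_eq_zero] using h
  have hx : ∀ p, c ⟨p, 0⟩ = 0 := eq_zero_of_shift c 0 fun p _ => by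
    have h := hs p
    rw [hy, hy, hz, hz] at h
    simpa [zmod_two_add_eq_zero] using h
  ext ⟨p, r⟩
  fin_cases r
  · exact hx p
  · exact hy p
  · exact hz p

lemma single_mem_sup_tree {H : AddSubgroup Chain} (hH : ∀ f : Face, toChain f.edges ∈ H)
    (e : Edge) : Finsupp.single e 1 ∈ H ⊔ chainsSupported treeEdges := by
  set K := H ⊔ chainsSupported treeEdges
  have htree : ∀ {e : Edge}, e ∈ treeEdges → Finsupp.single e 1 ∈ K := fun he =>
    AddSubgroup.mem_sup_right (single_mem_chainsSupported he)
  have hface : ∀ f : Face, ∑ e ∈ f.edges, Finsupp.single e 1 ∈ K := fun f =>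
    AddSubgroup.mem_sup_left (hH f)
  have hz : ∀ p : Vertex, Finsupp.single (⟨p, 2⟩ : Edge) (1 : ZMod 2) ∈ K := fun p =>
    htree ⟨fun h => absurd rfl h, fun h => absurd h (by decide : (2 : Fin 3) ≠ 0)⟩
  have hy : ∀ p : Vertex, Finsupp.single (⟨p, 1⟩ : Edge) (1 : ZMod 2) ∈ K := by
    refine of_unit_shift (r := 2) (fun p => ?_) fun p hp =>
      htree ⟨fun _ => hp, fun h => absurd h (by decide : (1 : Fin 3) ≠ 0)⟩
    have h := hface ⟨p, 0⟩
    rw [sum_face_edges_zero, ← add_assoc,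
      K.add_mem_cancel_right (K.add_mem (hz _) (hz _))] at h
    exact ⟨fun h1 => (K.add_mem_cancel_left h1).mp h, fun h1 => (K.add_mem_cancel_right h1).mp h⟩
  have hx : ∀ p : Vertex, Finsupp.single (⟨p, 0⟩ : Edge) (1 : ZMod 2) ∈ K := by
    refine of_unit_shift (r := 2) (fun p => ?_) fun p hp => ?_
    · have h := hface ⟨p, 1⟩
      rw [sum_face_edges_one, K.add_mem_cancel_left (hz _), K.add_mem_cancel_left (hz _)] at h
      exact ⟨fun h1 => (K.add_mem_cancel_left h1).mp h, fun h1 => (K.add_mem_cancel_right h1).mp h⟩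
    · revert p
      refine fun p => of_unit_shift (Q := fun p => p 2 = 0 →
        Finsupp.single (⟨p, 0⟩ : Edge) (1 : ZMod 2) ∈ K) (r := 1) (fun p => ?_)
        (fun p hp1 hp2 => htree ⟨fun _ => hp2, fun _ => hp1⟩) p
      have h := hface ⟨p, 2⟩
      rw [sum_face_edges_two, ← add_assoc,
        K.add_mem_cancel_right (K.add_mem (hy _) (hy _))] at h
      have h2 : (p + unit 1) 2 = p 2 := by simp [unit]
      rw [h2]
      exact imp_congr_right fun _ => ⟨fun h1 => (K.add_mem_cancel_left h1).mp h,
        fun h1 => (K.add_mem_cancel_right h1).mp h⟩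
  obtain ⟨p, r⟩ := e
  fin_cases r
  · exact hx p
  · exact hy p
  · exact hz p

/-- Every finite set of edges meeting all vertex stars evenly is generated by faces. -/
theorem cycle_induction {p : Finset Edge → Prop} (h0 : p ∅)
    (hadd : ∀ E F, p E → p F → p (symmDiff E F)) (hface : ∀ f : Face, p f.edges)
    {E : Finset Edge} (hE : ∀ v, Even (starEdges v ∩ E).card) : p E := by
  set Z := chainsEven starEdges
  set H := chainsOfPred p h0 hadd ⊓ Z
  have hH : ∀ f : Face, toChain f.edges ∈ H := fun f => by
    refine ⟨?_, fun v => sum_star_mem_face f v⟩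
    change p (toChain f.edges).support
    rw [support_toChain]
    exact hface f
  have hZ : toChain E ∈ Z := fun v => by
    rw [sum_toChain]
    exact (ZMod.natCast_eq_zero_iff_even).mpr (hE v)
  obtain ⟨c, hc, t, ht, hct⟩ := AddSubgroup.mem_sup.mp
    (mem_of_single_mem (single_mem_sup_tree hH) (toChain E))
  have : t = 0 := by
    refine cycle_eq_zero ?_ ht
    rw [← hct] at hZ
    exact (Z.add_mem_cancel_left hc.2).mp hZ
  rw [this, add_zero] at hct
  have h1 : p c.support := hc.1
  rwa [hct, support_toChain] at h1

/-! ## Uniqueness of the vacuum -/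

open Classical in
/-- The expectation values of the Pauli monomials in a vacuum. -/
lemma IsVacuum.apply {ω : Obs →ₗ[ℂ] ℂ} (h : IsVacuum ω) (E F : Finset Edge) :
    ω (prodX E * prodZ F) = if (∀ f : Face, Even (E ∩ f.edges).card) ∧
      (∀ v, Even (starEdges v ∩ F).card) then 1 else 0 := by
  have hX := fun E h1 => h.isState.absorb (star_prodX E) (prodX_mul_self E) h1
  have hZ := fun F h1 => h.isState.absorb (star_prodZ F) (prodZ_mul_self F) h1
  split_ifs with hEF
  · have h1 : ω (prodX E) = 1 := by
      refine cocycle_induction (p := fun E => ω (prodX E) = 1) ?_ (fun E F hE hF => ?_)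
        h.star_eq_one hEF.1
      · rw [prodX_empty, h.isState.map_one]
      · rw [← prodX_mul, (hX E hE _).1, hF]
    have h2 : ω (prodZ F) = 1 := by
      refine cycle_induction (p := fun F => ω (prodZ F) = 1) ?_ (fun E F hE hF => ?_)
        h.face_eq_one hEF.2
      · rw [prodZ_empty, h.isState.map_one]
      · rw [← prodZ_mul, (hZ E hE _).1, hF]
    rw [(hX E h1 _).1, h2]
  · rw [not_and_or, not_forall, not_forall] at hEF
    have hneg : ω (prodX E * prodZ F) = -ω (prodX E * prodZ F) := by
      rcases hEF with ⟨f, hf⟩ | ⟨v, hv⟩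
      · have hc : commSign E f.edges = -1 := (Nat.not_even_iff_odd.mp hf).neg_one_pow
        have h1 := hZ f.edges (h.face_eq_one f)
        have h2 : prodZ f.edges * (prodX E * prodZ F) =
            (-1 : ℂ) • (prodX E * prodZ F * prodZ f.edges) := by
          rw [← mul_assoc, prodZ_mul_prodX, hc, smul_mul_assoc, mul_assoc, prodZ_mul,
            symmDiff_comm, ← prodZ_mul, ← mul_assoc]
        exact (h1 _).1.symm.trans (by rw [h2, map_smul, (h1 _).2, neg_one_smul])
      · have hc : commSign (starEdges v) F = -1 := (Nat.not_even_iff_odd.mp hv).neg_one_pow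
        have h1 := hX (starEdges v) (h.star_eq_one v)
        have h2 : prodX E * prodZ F * prodX (starEdges v) =
            (-1 : ℂ) • (prodX (starEdges v) * (prodX E * prodZ F)) := by
          rw [mul_assoc, prodZ_mul_prodX, hc, mul_smul_comm, ← mul_assoc, prodX_mul,
            symmDiff_comm, ← prodX_mul, mul_assoc]
        exact (h1 _).2.symm.trans (by rw [h2, map_smul, (h1 _).1, neg_one_smul])
    exact self_eq_neg.mp hneg

theorem IsVacuum.unique {ω ω' : Obs →ₗ[ℂ] ℂ} (h : IsVacuum ω) (h' : IsVacuum ω') : ω = ω' :=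
  functional_ext (continuous_of_nonneg h.isState.nonneg) (continuous_of_nonneg h'.isState.nonneg)
    fun E F => by rw [h.apply, h'.apply]

/-! ## Locally finite homology and bounding sequences -/

/-- The four faces containing an edge. -/
def cofaces (e : Edge) : Finset Face :=
  {⟨e.base, e.dir + 1⟩, ⟨e.base - unit (e.dir + 2), e.dir + 1⟩,
   ⟨e.base, e.dir + 2⟩, ⟨e.base - unit (e.dir + 1), e.dir + 2⟩}

lemma mem_cofaces {e : Edge} {f : Face} : f ∈ cofaces e ↔ e ∈ f.edges := by
  obtain ⟨p, r⟩ := e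
  obtain ⟨b, s⟩ := f
  simp only [cofaces, Face.edges, Finset.mem_insert, Finset.mem_singleton, Face.mk.injEq,
    Edge.mk.injEq, eq_sub_iff_add_eq, eq_comm (a := b) (b := p), eq_comm (b := p) (a := b + _)]
  fin_cases r <;> fin_cases s <;> simp

lemma sum_cofaces {M : Type*} [AddCommMonoid M] (g : Face → M) (e : Edge) :
    ∑ f ∈ cofaces e, g f =
      g ⟨e.base, e.dir + 1⟩ + (g ⟨e.base - unit (e.dir + 2), e.dir + 1⟩ +
        (g ⟨e.base, e.dir + 2⟩ + g ⟨e.base - unit (e.dir + 1), e.dir + 2⟩)) := by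
  have h1 := fin_three_add_one_ne_add_two e.dir
  have h2 : ∀ (p : Vertex) (r : Fin 3), p ≠ p - unit r := fun p r h =>
    unit_ne_zero r (by simpa using h.symm)
  rw [cofaces, Finset.sum_insert, Finset.sum_insert, Finset.sum_insert, Finset.sum_singleton]
  all_goals simp [h1, h2]

lemma exists_int_primitive (g : ℤ → ZMod 2) (a : ZMod 2) :
    ∃ B : ℤ → ZMod 2, (∀ n, B n + B (n - 1) = g n) ∧ B 0 = a := by
  have h2 : ∀ x y : ZMod 2, x + y + x = y := by decide
  have h3 : ∀ x y : ZMod 2, x + (x + y) = y := by decide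
  refine ⟨fun n => match n with
    | .ofNat n => a + ∑ k ∈ Finset.range n, g (k + 1)
    | .negSucc n => a + ∑ k ∈ Finset.range (n + 1), g (-k), fun n => ?_, by simp⟩
  rcases n with (_ | n) | n
  · change (a + ∑ k ∈ Finset.range 0, g (k + 1)) + (a + ∑ k ∈ Finset.range 1, g (-k)) = g 0
    simp [h3]
  · have h : Int.ofNat (n + 1) - 1 = Int.ofNat n := by simp
    rw [h]
    simp only [Finset.sum_range_succ, ← add_assoc]
    have h4 : ∀ x y z : ZMod 2, x + y + z + x + y = z := by decide
    rw [h4]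
    simp
  · have h : Int.negSucc n - 1 = Int.negSucc (n + 1) := by lia
    rw [h]
    change (a + ∑ k ∈ Finset.range (n + 1), g (-k)) +
      (a + ∑ k ∈ Finset.range (n + 1 + 1), g (-k)) = _
    rw [Finset.sum_range_succ _ (n + 1), ← add_assoc a, h3]
    congr 1

lemma exists_primitive (r : Fin 3) (g init : Vertex → ZMod 2) :
    ∃ B : Vertex → ZMod 2, (∀ p, B p + B (p - unit r) = g p) ∧ ∀ p, p r = 0 → B p = init p := by
  choose β hβ hβ0 using fun q : Vertex =>
    exists_int_primitive (fun n => g (Function.update q r n)) (init q)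
  refine ⟨fun p => β (Function.update p r 0) (p r), fun p => ?_, fun p hp => ?_⟩
  · have h1 : Function.update (p - unit r) r 0 = Function.update p r 0 := by
      funext i
      by_cases hi : i = r
      · subst hi; simp
      · simp [hi, unit_apply_ne hi]
    simp only [h1, Pi.sub_apply, unit_apply_self, hβ, Function.update_idem,
      Function.update_eq_self]
  · have h1 : Function.update p r 0 = p := by rw [← hp, Function.update_eq_self]
    simp only [h1, hp, hβ0]

/-- Every locally finite cycle is the boundary of a locally finite family of faces. -/
theorem exists_boundary {c : Edge → ZMod 2} (hc : ∀ v, ∑ e ∈ starEdges v, c e = 0) :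
    ∃ b : Face → ZMod 2, ∀ e, ∑ f ∈ cofaces e, b f = c e := by
  obtain ⟨B, hB, -⟩ := exists_primitive 2 (fun p => c ⟨p, 0⟩) 0
  obtain ⟨I, hI, -⟩ := exists_primitive 1 (fun p => c ⟨p, 2⟩ + (B p + B (p - unit 0))) 0
  obtain ⟨A, hA, hAI⟩ := exists_primitive 2 (fun p => c ⟨p, 1⟩) I
  have hD : ∀ p, A p + A (p - unit 1) + (B p + B (p - unit 0)) = c ⟨p, 2⟩ := by
    refine of_unit_shift (r := 2) (fun p => ?_) fun p hp => ?_
    · have h := hc (p + unit 2)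
      have hA0 := hA (p + unit 2)
      have hA1 := hA (p + unit 2 - unit 1)
      have hB0 := hB (p + unit 2)
      have hB1 := hB (p + unit 2 - unit 0)
      rw [sum_starEdges, add_sub_cancel_right, ← hA0, ← hA1, ← hB0, ← hB1, add_sub_cancel_right,
        sub_right_comm _ (unit 1), sub_right_comm _ (unit 0), add_sub_cancel_right] at h
      generalize A (p + unit 2) = a1 at *
      generalize A (p + unit 2 - unit 1) = a2 at *
      generalize A (p - unit 1) = a3 at *
      generalize A p = a4 at *
      generalize B (p + unit 2) = b1 at *
      generalize B (p + unit 2 - unit 0) = b2 at *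
      generalize B (p - unit 0) = b3 at *
      generalize B p = b4 at *
      generalize c ⟨p + unit 2, 2⟩ = c1 at *
      generalize c ⟨p, 2⟩ = c2 at *
      have h5 : (a4 + a3 + (b4 + b3) + c2) + (a1 + a2 + (b1 + b2) + c1) = 0 := by
        linear_combination h
      rw [zmod_two_add_eq_zero] at h5
      rw [← zmod_two_add_eq_zero, h5, zmod_two_add_eq_zero]
    · rw [hAI p hp, hAI (p - unit 1) (by simpa [unit] using hp), hI]
      have h4 : ∀ x y : ZMod 2, x + y + y = x := by decide
      exact h4 _ _
  refine ⟨fun f => if f.normal = 0 then A f.base else if f.normal = 1 then B f.base else 0,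
    fun ⟨p, r⟩ => ?_⟩
  rw [sum_cofaces]
  fin_cases r
  · simpa using hB p
  · simpa using hA p
  · simpa [add_assoc] using hD p

/-- The faces with all base coordinates between `-n` and `n`. -/
noncomputable def faceBox (n : ℕ) : Finset Face :=
  (Finset.Icc (fun _ => -(n : ℤ)) (fun _ => (n : ℤ)) ×ˢ Finset.univ).image
    fun x : Vertex × Fin 3 => ⟨x.1, x.2⟩

lemma mem_faceBox {n : ℕ} {f : Face} : f ∈ faceBox n ↔ ∀ i, -(n : ℤ) ≤ f.base i ∧ f.base i ≤ n := by
  simp only [faceBox, Finset.mem_image, Finset.mem_product, Finset.mem_univ, and_true,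
    Finset.mem_Icc, Pi.le_def, Prod.exists]
  constructor
  · rintro ⟨p, r, ⟨h1, h2⟩, rfl⟩ i
    exact ⟨h1 i, h2 i⟩
  · exact fun h => ⟨f.base, f.normal, ⟨fun i => (h i).1, fun i => (h i).2⟩, rfl⟩

lemma faceBox_mono : Monotone faceBox := fun m n h f hf => by
  rw [mem_faceBox] at hf ⊢
  exact fun i => ⟨by linarith [(hf i).1, Int.ofNat_le.mpr h], by
    linarith [(hf i).2, Int.ofNat_le.mpr h]⟩

lemma eventually_mem_faceBox (f : Face) : ∀ᶠ n in atTop, f ∈ faceBox n := by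
  filter_upwards [eventually_ge_atTop (∑ i, (f.base i).natAbs)] with n hn
  rw [mem_faceBox]
  intro i
  have := (Finset.single_le_sum (f := fun i => (f.base i).natAbs) (fun _ _ => Nat.zero_le _)
    (Finset.mem_univ i)).trans hn
  lia

/-- Every set of edges meeting all vertex stars evenly is exhausted by boundaries of an increasing
sequence of finite sets of faces. -/
theorem exists_exhaustion {T : Set Edge} {c : Edge → ZMod 2} (hT : ∀ e, c e = 1 ↔ e ∈ T)
    (hc : ∀ v, ∑ e ∈ starEdges v, c e = 0) :
    ∃ S : ℕ → Finset Face, Monotone S ∧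
      ∀ e, ∀ᶠ n in atTop, (e ∈ boundary (S n) ↔ e ∈ T) := by
  obtain ⟨b, hb⟩ := exists_boundary hc
  refine ⟨fun n => (faceBox n).filter fun f => b f = 1,
    fun m n h => Finset.filter_subset_filter _ (faceBox_mono h), fun e => ?_⟩
  have hev : ∀ᶠ n in atTop, ∀ f ∈ cofaces e, f ∈ faceBox n :=
    (Filter.eventually_all_finset _).mpr fun f _ => eventually_mem_faceBox f
  filter_upwards [hev] with n hn
  have hset : ((faceBox n).filter fun f => b f = 1).filter (fun f => e ∈ f.edges) =
      (cofaces e).filter fun f => b f = 1 := by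
    ext f
    simp only [Finset.mem_filter, ← mem_cofaces]
    exact ⟨fun h => ⟨h.2, h.1.2⟩, fun h => ⟨⟨hn f h.1, h.2⟩, h.1⟩⟩
  have hsum : ∑ f ∈ cofaces e, b f = (((cofaces e).filter fun f => b f = 1).card : ZMod 2) := by
    rw [Finset.card_filter, Nat.cast_sum]
    refine Finset.sum_congr rfl fun f _ => ?_
    generalize b f = x
    revert x
    decide
  change Odd _ ↔ _
  rw [hset, ← ZMod.natCast_eq_one_iff_odd, ← hsum, hb, hT]

/-! ## Infinite paths are locally finite cycles -/

lemma mem_starEdges_iff_source_or_target (e : OrientedEdge) (v : Vertex) :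
    e.edge ∈ starEdges v ↔ e.source = v ∨ e.target = v := by
  rw [mem_starEdges, OrientedEdge.source, OrientedEdge.target]
  cases e.reversed
  · simp
  · simp [or_comm]

section Path

variable {γ : ℤ → OrientedEdge} (hγ : IsInfinitePath γ)

include hγ

lemma IsInfinitePath.target_eq (t : ℤ) : (γ t).target = (γ (t + 1)).source :=
  (hγ t (t + 1)).1 t (by simp)

lemma IsInfinitePath.sum_bdry (a : ℤ) (n : ℕ) : ∑ t ∈ Finset.Ico a (a + n), (γ t).bdry =
    Finsupp.single (γ (a + n)).source 1 - Finsupp.single (γ a).source 1 := by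
  induction n with
  | zero => simp
  | succ n ih =>
    have h : Finset.Ico a (a + (n + 1 : ℕ)) = insert (a + n) (Finset.Ico a (a + n)) := by
      ext t
      simp only [Finset.mem_Ico, Finset.mem_insert]
      lia
    rw [h, Finset.sum_insert (by simp), ih, OrientedEdge.bdry, hγ.target_eq]
    push_cast
    rw [add_assoc]
    abel

lemma IsInfinitePath.source_ne {a b : ℤ} (hab : a < b) : (γ a).source ≠ (γ b).source := by
  intro h
  obtain ⟨n, hn⟩ := Int.le.dest hab.le
  refine (hγ a b).2 (Finset.Ico a b) ?_ ⟨a, by simpa using hab⟩ ?_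
  · refine Finset.ssubset_iff_subset_ne.mpr ⟨Finset.Ico_subset_Icc_self, fun h => ?_⟩
    have h1 : b ∈ Finset.Ico a b := h ▸ Finset.right_mem_Icc.mpr hab.le
    simp at h1
  · rw [← hn, hγ.sum_bdry, hn, h, sub_self]

lemma IsInfinitePath.source_injective : Function.Injective fun t => (γ t).source := by
  intro a b h
  rcases lt_trichotomy a b with hab | hab | hab
  · exact absurd h (hγ.source_ne hab)
  · exact hab
  · exact absurd h.symm (hγ.source_ne hab)

lemma IsInfinitePath.edge_ne_succ (t : ℤ) : (γ t).edge ≠ (γ (t + 1)).edge := by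
  intro h
  have h1 := hγ.target_eq t
  have h2 : (γ t).source = (γ (t + 1)).source ∨ (γ t).source = (γ (t + 1)).target := by
    rw [OrientedEdge.source, OrientedEdge.source, OrientedEdge.target, h]
    cases (γ t).reversed <;> cases (γ (t + 1)).reversed <;> simp
  rcases h2 with h2 | h2
  · exact hγ.source_ne (by lia) h2
  · rw [hγ.target_eq] at h2
    exact hγ.source_ne (by lia) h2

open Classical in
lemma IsInfinitePath.sum_star (v : Vertex) :
    ∑ e ∈ starEdges v, (if e ∈ support γ then (1 : ZMod 2) else 0) = 0 := by
  rw [Finset.sum_boole]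
  have hmem : ∀ s, (γ s).edge ∈ starEdges v ↔ (γ s).source = v ∨ (γ (s + 1)).source = v := by
    intro s
    rw [mem_starEdges_iff_source_or_target, hγ.target_eq]
  by_cases hv : ∃ t, (γ t).source = v
  · obtain ⟨t, ht⟩ := hv
    have hset : (starEdges v).filter (fun e => e ∈ support γ) =
        {(γ (t - 1)).edge, (γ t).edge} := by
      ext e
      simp only [Finset.mem_filter, Finset.mem_insert, Finset.mem_singleton]
      constructor
      · rintro ⟨h1, s, rfl⟩
        rcases (hmem s).mp h1 with h | h
        · exact Or.inr (by rw [hγ.source_injective (h.trans ht.symm)])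
        · have h2 : s + 1 = t := hγ.source_injective (h.trans ht.symm)
          exact Or.inl (by rw [← h2, add_sub_cancel_right])
      · rintro (rfl | rfl)
        · exact ⟨(hmem _).mpr (Or.inr (by rw [sub_add_cancel, ht])), _, rfl⟩
        · exact ⟨(hmem _).mpr (Or.inl ht), _, rfl⟩
    have hne := hγ.edge_ne_succ (t - 1)
    rw [sub_add_cancel] at hne
    rw [hset, Finset.card_pair hne]
    rfl
  · rw [Finset.filter_false_of_mem, Finset.card_empty, Nat.cast_zero]
    rintro e he ⟨s, rfl⟩
    rcases (hmem s).mp he with h | h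
    · exact hv ⟨_, h⟩
    · exact hv ⟨_, h⟩

theorem IsInfinitePath.exists_isBoundingSequence :
    ∃ S : ℕ → Finset Face, IsBoundingSequence γ S := by
  classical
  obtain ⟨S, h1, h2⟩ := exists_exhaustion (T := support γ)
    (c := fun e => if e ∈ support γ then 1 else 0) (fun e => by simp) hγ.sum_star
  exact ⟨S, h1, h2⟩

end Path

end ToricCode

theorem mainTheorem10 :
    ∃ ω : Obs →ₗ[ℂ] ℂ,
      (∀ ω' : Obs →ₗ[ℂ] ℂ, IsVacuum ω' ↔ ω' = ω) ∧
      IsPure ω ∧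
      (∀ v : Vertex, ∃! α : Obs ≃⋆ₐ[ℂ] Obs, IsChargeAut v α) ∧
      (∀ γ : ℤ → OrientedEdge, IsInfinitePath γ →
        (∃ S : ℕ → Finset Face, IsBoundingSequence γ S) ∧
        ∀ S : ℕ → Finset Face, IsBoundingSequence γ S →
          ∃! β : Obs ≃⋆ₐ[ℂ] Obs, IsFluxAut S β) ∧
      ∀ (n m : ℕ) (v : Fin n → Vertex) (γ : Fin m → ℤ → OrientedEdge)
        (S : Fin m → ℕ → Finset Face) (α : Fin n → Obs ≃⋆ₐ[ℂ] Obs) (β : Fin m → Obs ≃⋆ₐ[ℂ] Obs),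
        (∀ j, IsInfinitePath (γ j)) → (∀ j, IsBoundingSequence (γ j) (S j)) →
        (∀ i, IsChargeAut (v i) (α i)) → (∀ j, IsFluxAut (S j) (β j)) →
        IsPure (pullback ω ((List.ofFn α).prod * (List.ofFn β).prod)) := by
  obtain ⟨ω, hω⟩ := exists_isVacuum
  have huniq : ∀ ω' : Obs →ₗ[ℂ] ℂ, IsVacuum ω' ↔ ω' = ω :=
    fun ω' => ⟨fun h => h.unique hω, fun h => h ▸ hω⟩
  exact ⟨ω, huniq, isPure_of_unique huniq, existsUnique_chargeAut,
    fun γ hγ => ⟨hγ.exists_isBoundingSequence, fun S hS => existsUnique_fluxAut hS.mono⟩,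
    fun n m v γ S α β _ _ _ _ => (isPure_of_unique huniq).pullback _⟩
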